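/- Let $\sigma>1$, let $U\subseteq\mathbf R^d$ be open, let $\Gamma\subseteq\mathbf R^d$ be an open cone with dual cone $\Gamma^0=\{\xi\in\mathbf R^d : y\cdot\xi\ge 0 \text{ for all } y\in\Gamma\}$, let $\gamma>0$, and let $F$ be an analytic function on $Z=\{x+iy\in\mathbf C^d : x\in U,\ y\in\Gamma,\ |y|<\gamma\}$. Notation. For $\tau,h>0$ and compact $K$ put $\|\varphi\|_{\tau,\sigma,h,K}=\sup_{\alpha\in\mathbf N^d}\sup_{x\in K}\dfrac{|\partial^\alpha\varphi(x)|}{h^{|\alpha|^\sigma}|\alpha|^{\tau|\alpha|^\sigma}}$. The space $\mathcal D_{(\tau,\sigma)}(U)$ (resp. $\mathcal D_{\{\tau,\sigma\}}(U)$) consists of the $\varphi\in C^\infty(\mathbf R^d)$ supported in some compact $K\subset U$ with $\|\varphi\|_{\tau,\sigma,h,K}<\infty$ for every (resp. some) $h>0$. Its dual $\mathcal D'_{(\tau,\sigma)}(U)$ (resp. $\mathcal D'_{\{\tau,\sigma\}}(U)$) consists of the linear functionals $u$ such that for every compact $K\subset U$, for some (resp. every) $h>0$, there is $C$ with $|\langle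 u,\varphi\rangle|\le C\|\varphi\|_{\tau,\sigma,h,K}$ for all test functions $\varphi$ supported in $K$. The index $\tau,\sigma$ without brackets stands for either $(\tau,\sigma)$ or $\{\tau,\sigma\}$, the same choice throughout. Let $\mathcal D^{(\sigma)}(U)=\varprojlim_{\tau\to0}\mathcal D_{\tau,\sigma}(U)$ and $\mathcal D^{\{\sigma\}}(U)=\varinjlim_{\tau\to\infty}\mathcal D_{\tau,\sigma}(U)$, with duals $\mathcal D'^{(\sigma)}(U)$ and $\mathcal D'^{\{\sigma\}}(U)$. Let $T_{\tau,\sigma,h}(t)=\sup_{p\in\mathbf N}\ln\dfrac{h^{p^\sigma}t^p}{p^{\tau p^\sigma}}$ for $t>0$, and $T_{\tau,\sigma,h}(0)=0$. For $u$ in any of these dual spaces, with test space $X$, and for $(x_0,\xi_0)\in U\times(\mathbf R^d\setminus\{0\})$, we say that $(x_0,\xi_0)\notin \operatorname{WF}_{(\rho,\sigma)}(u)$ (resp. $\notin\operatorname{WF}_{\{\rho,\sigma\}}(u)$) if there are an open cone $V\ni\xi_0$, a compact neighbourhood $K$ of $x_0$ and a $\varphi\in X\cap\mathcal D_{(\rho,\sigma)}(U)$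 (resp. $\varphi\in X\cap\mathcal D_{\{\rho,\sigma\}}(U)$) with $\operatorname{supp}\varphi\subseteq K$ and $\varphi=1$ near $x_0$, such that for every $h>0$ there is $A>0$ (resp. for some $h,A>0$) with $|\widehat{\varphi u}(\xi)|\le A\exp\{-T_{\rho,\sigma,h}(|\xi|)\}$ for all $\xi\in V$, where $\widehat{\varphi u}(\xi)=\langle u,\varphi e^{-i\langle\cdot,\xi\rangle}\rangle$. Put $\operatorname{WF}^{(\sigma)}(u)=\bigcup_{\tau>0}\operatorname{WF}_{\tau,\sigma}(u)$ for $u\in\mathcal D'^{(\sigma)}(U)$ and $\operatorname{WF}^{\{\sigma\}}(u)=\bigcap_{\tau>0}\operatorname{WF}_{\tau,\sigma}(u)$ for $u\in\mathcal D'^{\{\sigma\}}(U)$. Finally, $u=F(x+i\Gamma0)$ means that $\int F(x+iy)\varphi(x)\,dx\to\langle u,\varphi\rangle$ as $y\to0$, $y\in\Gamma$, for every test function $\varphi$. **Theorem.** (1) Suppose that for some $A,H>0$ (resp. for every $H>0$ there is $A>0$ such that) $$|F(x+iy)|\le A\,|y|^{-H\left(\frac{\ln(1/|y|)}{\ln(\ln(1/|y|))}\right)^{\frac1{\sigma-1}}},\qquad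 x+iy\in Z,\ 0<|y|<1/e,$$ and let $u=F(x+i\Gamma0)\in\mathcal D'^{(\sigma)}(U)$ (resp. $\mathcal D'^{\{\sigma\}}(U)$). Then $\operatorname{WF}^{(\sigma)}(u)\subseteq U\times\Gamma^0$ (resp. $\operatorname{WF}^{\{\sigma\}}(u)\subseteq U\times\Gamma^0$). (2) More precisely, let $\tau>0$, suppose that for every $H>0$ there is $A>0$ (resp. for some $A,H>0$) $$|F(x+iy)|\le A\exp\{T_{(2^\sigma-1)\tau,\sigma,H}(1/|y|)\},\qquad x+iy\in Z,\ y\neq0,$$ and let $u=F(x+i\Gamma0)\in\mathcal D'_{\{\tau/2^{\sigma-1},\sigma\}}(U)$ (resp. $\mathcal D'_{(\tau/2^{\sigma-1},\sigma)}(U)$). Then $\operatorname{WF}_{\{(2^\sigma-1)\tau,\sigma\}}(u)\subseteq U\times\Gamma^0$ (resp. $\operatorname{WF}_{((2^\sigma-1)\tau,\sigma)}(u)\subseteq U\times\Gamma^0$). -/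

import Mathlib

open Filter Topology MeasureTheory
open scoped ENNReal NNReal ContDiff

/-- Real Euclidean space of dimension `d`. -/
abbrev RSpace (d : ℕ) := EuclideanSpace ℝ (Fin d)

/-- Complex Euclidean space of dimension `d`. -/
abbrev CSpace (d : ℕ) := EuclideanSpace ℂ (Fin d)

/-- The two types of spaces: Beurling, written `(τ, σ)`, and Roumieu, written `{τ, σ}`. -/
inductive UltraType where
  | beurling
  | roumieu

/-- The quantifier over the parameter `h > 0` in the definition of the test spaces and of the
wave front sets: "for every `h > 0`" in the Beurling case, "for some `h > 0`" in the Roumieu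
case. -/
def UltraType.quant : UltraType → (ℝ → Prop) → Prop
  | .beurling, P => ∀ h : ℝ, 0 < h → P h
  | .roumieu, P => ∃ h : ℝ, 0 < h ∧ P h

/-- The quantifier over `h > 0` in the description of the dual spaces: "for some `h > 0`" in the
Beurling case, "for every `h > 0`" in the Roumieu case. -/
def UltraType.dualQuant : UltraType → (ℝ → Prop) → Prop
  | .beurling, P => ∃ h : ℝ, 0 < h ∧ P h
  | .roumieu, P => ∀ h : ℝ, 0 < h → P h

noncomputable section

/-- The weight `h ^ (n ^ σ) * n ^ (τ n ^ σ)`; it is `1` for `n = 0` and `σ > 1`. -/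
def gevreyWeight (τ σ h : ℝ) (n : ℕ) : ℝ :=
  h ^ ((n : ℝ) ^ σ) * (n : ℝ) ^ (τ * (n : ℝ) ^ σ)

/-- The partial derivative `∂_{i 0} ⋯ ∂_{i (n - 1)} φ (x)` of order `n`. The multi-index
derivatives `∂^α φ` with `|α| = n` of a smooth function are exactly these. -/
def partialD {d n : ℕ} (i : Fin n → Fin d) (φ : RSpace d → ℂ) (x : RSpace d) : ℂ :=
  iteratedFDeriv ℝ n φ x (fun j => EuclideanSpace.single (i j) (1 : ℝ))

/-- The norm of `𝓔_{τ,σ,h}(K)`: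
`sup_α sup_{x ∈ K} |∂^α φ (x)| / (h ^ (|α| ^ σ) * |α| ^ (τ |α| ^ σ))`, possibly infinite. -/
def ultraNorm {d : ℕ} (τ σ h : ℝ) (K : Set (RSpace d)) (φ : RSpace d → ℂ) : ℝ≥0∞ :=
  ⨆ (n : ℕ) (i : Fin n → Fin d), ⨆ x ∈ K,
    ENNReal.ofReal (‖partialD i φ x‖ / gevreyWeight τ σ h n)

theorem partialD_eq_zero {d n : ℕ} (i : Fin n → Fin d) (φ : RSpace d → ℂ) {x : RSpace d}
    (hx : x ∉ tsupport φ) : partialD i φ x = 0 := by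
  have h : iteratedFDeriv ℝ n φ x = 0 := by
    by_contra hne
    exact hx (support_iteratedFDeriv_subset n hne)
  simp [partialD, h]

theorem gevreyWeight_nonneg {τ σ h : ℝ} (hh : 0 < h) (n : ℕ) : 0 ≤ gevreyWeight τ σ h n := by
  unfold gevreyWeight
  positivity

/-- Only the values on the support of the function matter. -/
theorem ultraNorm_le_of_tsupport {d : ℕ} (τ σ h : ℝ) {K L : Set (RSpace d)} {φ : RSpace d → ℂ}
    (hK : tsupport φ ⊆ K) : ultraNorm τ σ h L φ ≤ ultraNorm τ σ h K φ := by
  unfold ultraNorm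
  refine iSup_mono fun n => iSup_mono fun i => iSup₂_le fun x _ => ?_
  by_cases hx : x ∈ tsupport φ
  · exact le_iSup₂ (f := fun (y : RSpace d) (_ : y ∈ K) =>
      ENNReal.ofReal (‖partialD i φ y‖ / gevreyWeight τ σ h n)) x (hK hx)
  · simp [partialD_eq_zero i φ hx]

theorem ultraNorm_mono {d : ℕ} {τ σ h h' : ℝ} (hh : 0 < h) (hle : h ≤ h') (K : Set (RSpace d))
    (φ : RSpace d → ℂ) : ultraNorm τ σ h' K φ ≤ ultraNorm τ σ h K φ := by
  unfold ultraNorm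
  refine iSup_mono fun n => iSup_mono fun i => iSup_mono fun x => iSup_mono fun _ => ?_
  refine ENNReal.ofReal_le_ofReal ?_
  rcases Nat.eq_zero_or_pos n with rfl | hn
  · unfold gevreyWeight
    have h0 : 0 ≤ ((0 : ℕ) : ℝ) ^ (τ * ((0 : ℕ) : ℝ) ^ σ) := by positivity
    rcases h0.eq_or_lt with h0 | h0
    · rw [← h0]
      simp
    · gcongr
  · have hn' : (0 : ℝ) < n := by exact_mod_cast hn
    unfold gevreyWeight
    gcongr

theorem ultraNorm_add_le {d : ℕ} {τ σ h : ℝ} (hh : 0 < h) (K : Set (RSpace d))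
    {φ ψ : RSpace d → ℂ} (hφ : ContDiff ℝ ∞ φ) (hψ : ContDiff ℝ ∞ ψ) :
    ultraNorm τ σ h K (φ + ψ) ≤ ultraNorm τ σ h K φ + ultraNorm τ σ h K ψ := by
  refine iSup₂_le fun n i => iSup₂_le fun x hx => ?_
  have e : partialD i (φ + ψ) x = partialD i φ x + partialD i ψ x := by
    unfold partialD
    rw [iteratedFDeriv_add_apply (hφ.contDiffAt.of_le (by exact_mod_cast le_top))
      (hψ.contDiffAt.of_le (by exact_mod_cast le_top))]
    rfl
  have key : ∀ f : RSpace d → ℂ, ENNReal.ofReal (‖partialD i f x‖ / gevreyWeight τ σ h n)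
      ≤ ultraNorm τ σ h K f := fun f =>
    le_trans (le_iSup₂ (f := fun (y : RSpace d) (_ : y ∈ K) =>
      ENNReal.ofReal (‖partialD i f y‖ / gevreyWeight τ σ h n)) x hx)
      (le_iSup₂ (f := fun (m : ℕ) (l : Fin m → Fin d) => ⨆ y ∈ K,
      ENNReal.ofReal (‖partialD l f y‖ / gevreyWeight τ σ h m)) n i)
  refine le_trans ?_ (add_le_add (key φ) (key ψ))
  have hw := gevreyWeight_nonneg (τ := τ) (σ := σ) hh n
  rw [← ENNReal.ofReal_add (by positivity) (by positivity), ← add_div, e]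
  exact ENNReal.ofReal_le_ofReal (by gcongr; exact norm_add_le _ _)

theorem ultraNorm_smul_le {d : ℕ} {τ σ h : ℝ} (K : Set (RSpace d)) (c : ℂ)
    {φ : RSpace d → ℂ} (hφ : ContDiff ℝ ∞ φ) :
    ultraNorm τ σ h K (c • φ) ≤ ENNReal.ofReal ‖c‖ * ultraNorm τ σ h K φ := by
  refine iSup₂_le fun n i => iSup₂_le fun x hx => ?_
  have e : partialD i (c • φ) x = c * partialD i φ x := by
    unfold partialD
    rw [iteratedFDeriv_const_smul_apply (hφ.contDiffAt.of_le (by exact_mod_cast le_top))]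
    rfl
  rw [e, norm_mul, mul_div_assoc, ENNReal.ofReal_mul (norm_nonneg c)]
  gcongr
  exact le_trans (le_iSup₂ (f := fun (y : RSpace d) (_ : y ∈ K) =>
      ENNReal.ofReal (‖partialD i φ y‖ / gevreyWeight τ σ h n)) x hx)
      (le_iSup₂ (f := fun (m : ℕ) (l : Fin m → Fin d) => ⨆ y ∈ K,
      ENNReal.ofReal (‖partialD l φ y‖ / gevreyWeight τ σ h m)) n i)

/-- The test spaces `𝓓_{(τ,σ)}(U)` (Beurling) and `𝓓_{{τ,σ}}(U)` (Roumieu): smooth functions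
supported in some compact `K ⊆ U` whose norm in `𝓔_{τ,σ,h}(K)` is finite for every `h > 0`,
respectively for some `h > 0`. -/
def testSpace {d : ℕ} (k : UltraType) (τ σ : ℝ) (U : Set (RSpace d)) :
    Submodule ℂ (RSpace d → ℂ) where
  carrier := {φ | ContDiff ℝ ∞ φ ∧ ∃ K : Set (RSpace d), IsCompact K ∧ K ⊆ U ∧ tsupport φ ⊆ K ∧
    k.quant fun h => ultraNorm τ σ h K φ < ⊤}
  zero_mem' := by
    refine ⟨contDiff_const, ∅, isCompact_empty, Set.empty_subset _, by simp [tsupport], ?_⟩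
    cases k
    · intro h _
      simp [ultraNorm]
    · exact ⟨1, one_pos, by simp [ultraNorm]⟩
  add_mem' := by
    rintro φ ψ ⟨hφ, K, hK, hKU, hsK, hqK⟩ ⟨hψ, L, hL, hLU, hsL, hqL⟩
    refine ⟨hφ.add hψ, K ∪ L, hK.union hL, Set.union_subset hKU hLU, ?_, ?_⟩
    · exact (tsupport_add φ ψ).trans (Set.union_subset_union hsK hsL)
    · have key : ∀ h, 0 < h → ultraNorm τ σ h K φ < ⊤ → ultraNorm τ σ h L ψ < ⊤ →
          ultraNorm τ σ h (K ∪ L) (φ + ψ) < ⊤ := fun h hh h1 h2 =>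
        lt_of_le_of_lt (ultraNorm_add_le hh _ hφ hψ) (ENNReal.add_lt_top.2
          ⟨(ultraNorm_le_of_tsupport τ σ h hsK).trans_lt h1,
            (ultraNorm_le_of_tsupport τ σ h hsL).trans_lt h2⟩)
      cases k
      · exact fun h hh => key h hh (hqK h hh) (hqL h hh)
      · obtain ⟨h1, p1, q1⟩ := hqK
        obtain ⟨h2, p2, q2⟩ := hqL
        exact ⟨max h1 h2, lt_max_of_lt_left p1, key _ (lt_max_of_lt_left p1)
          ((ultraNorm_mono p1 (le_max_left _ _) _ _).trans_lt q1)
          ((ultraNorm_mono p2 (le_max_right _ _) _ _).trans_lt q2)⟩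
  smul_mem' := by
    rintro c φ ⟨hφ, K, hK, hKU, hsK, hqK⟩
    refine ⟨contDiff_const.smul hφ, K, hK, hKU, ?_, ?_⟩
    · exact (closure_mono (Function.support_const_smul_subset c φ)).trans hsK
    · have key : ∀ h, ultraNorm τ σ h K φ < ⊤ → ultraNorm τ σ h K (c • φ) < ⊤ := fun h h1 =>
        lt_of_le_of_lt (ultraNorm_smul_le K c hφ) (ENNReal.mul_lt_top ENNReal.ofReal_lt_top h1)
      cases k
      · exact fun h hh => key h (hqK h hh)
      · obtain ⟨h1, p1, q1⟩ := hqK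
        exact ⟨h1, p1, key h1 q1⟩

/-- `𝓓^{(σ)}(U)`, the intersection (projective limit as `τ → 0`) of the spaces
`𝓓_{τ,σ}(U)`, `τ > 0`. -/
def testSpaceInter {d : ℕ} (k : UltraType) (σ : ℝ) (U : Set (RSpace d)) :
    Submodule ℂ (RSpace d → ℂ) :=
  ⨅ τ : Set.Ioi (0 : ℝ), testSpace k τ σ U

/-- `𝓓^{{σ}}(U)`, the union (inductive limit as `τ → ∞`) of the increasing family of
spaces `𝓓_{τ,σ}(U)`, `τ > 0`. -/
def testSpaceUnion {d : ℕ} (k : UltraType) (σ : ℝ) (U : Set (RSpace d)) :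
    Submodule ℂ (RSpace d → ℂ) :=
  ⨆ τ : Set.Ioi (0 : ℝ), testSpace k τ σ U

theorem testSpace_mono {d : ℕ} (k : UltraType) {τ τ' σ : ℝ} (hσ : 1 < σ) (hle : τ ≤ τ')
    (U : Set (RSpace d)) : testSpace k τ σ U ≤ testSpace k τ' σ U := by
  rintro φ ⟨hφ, K, hK, hKU, hsK, hqK⟩
  refine ⟨hφ, K, hK, hKU, hsK, ?_⟩
  have key : ∀ h, 0 < h → ultraNorm τ' σ h K φ ≤ ultraNorm τ σ h K φ := by
    intro h hh
    unfold ultraNorm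
    refine iSup_mono fun n => iSup_mono fun i => iSup_mono fun x => iSup_mono fun _ => ?_
    refine ENNReal.ofReal_le_ofReal ?_
    unfold gevreyWeight
    rcases Nat.eq_zero_or_pos n with rfl | hn
    · rw [Nat.cast_zero, Real.zero_rpow (by linarith : σ ≠ 0), mul_zero, mul_zero]
    · have hn' : (1 : ℝ) ≤ n := by exact_mod_cast hn
      gcongr
  cases k
  · exact fun h hh => (key h hh).trans_lt (hqK h hh)
  · obtain ⟨h1, p1, q1⟩ := hqK
    exact ⟨h1, p1, (key h1 p1).trans_lt q1⟩

/-- The supremum in `testSpaceUnion` is the union. -/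
theorem mem_testSpaceUnion {d : ℕ} (k : UltraType) {σ : ℝ} (hσ : 1 < σ) (U : Set (RSpace d))
    (φ : RSpace d → ℂ) : φ ∈ testSpaceUnion k σ U ↔ ∃ τ : ℝ, 0 < τ ∧ φ ∈ testSpace k τ σ U := by
  have : Nonempty (Set.Ioi (0 : ℝ)) := ⟨⟨1, Set.mem_Ioi.2 one_pos⟩⟩
  unfold testSpaceUnion
  rw [Submodule.mem_iSup_of_directed]
  · constructor
    · rintro ⟨⟨τ, hτ⟩, h⟩
      exact ⟨τ, hτ, h⟩
    · rintro ⟨τ, hτ, h⟩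
      exact ⟨⟨τ, hτ⟩, h⟩
  · intro a b
    exact ⟨max a b, testSpace_mono k hσ (le_max_left (a : ℝ) b) U,
      testSpace_mono k hσ (le_max_right (a : ℝ) b) U⟩

/-- Continuity of a linear functional on the elements of `𝓓_{τ,σ}(U)` that lie in its domain `X`:
for every compact `K ⊆ U` there are `h > 0` and `C` (Beurling case), respectively for every
compact `K ⊆ U` and every `h > 0` there is `C` (Roumieu case), such that
`|u(φ)| ≤ C ‖φ‖` in the norm of `𝓔_{τ,σ,h}(K)` for all those `φ` supported in `K`. -/
def ContinuousOnStep {d : ℕ} (k : UltraType) (τ σ : ℝ) (U : Set (RSpace d))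
    {X : Submodule ℂ (RSpace d → ℂ)} (u : X →ₗ[ℂ] ℂ) : Prop :=
  ∀ K : Set (RSpace d), IsCompact K → K ⊆ U →
    k.dualQuant fun h => ∃ C : ℝ≥0, ∀ φ : X, (φ : RSpace d → ℂ) ∈ testSpace k τ σ U →
      tsupport (φ : RSpace d → ℂ) ⊆ K →
      ‖u φ‖ₑ ≤ C * ultraNorm τ σ h K (φ : RSpace d → ℂ)

/-- `u ∈ 𝓓'_{τ,σ}(U)`. -/
def IsUltradistribution {d : ℕ} (k : UltraType) (τ σ : ℝ) (U : Set (RSpace d))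
    (u : testSpace k τ σ U →ₗ[ℂ] ℂ) : Prop :=
  ContinuousOnStep k τ σ U u

/-- `u ∈ 𝓓'^{(σ)}(U)`: continuity for the projective limit topology of `𝓓^{(σ)}(U)`. -/
def IsUltradistributionInter {d : ℕ} (k : UltraType) (σ : ℝ) (U : Set (RSpace d))
    (u : testSpaceInter k σ U →ₗ[ℂ] ℂ) : Prop :=
  ∃ τ : ℝ, 0 < τ ∧ ContinuousOnStep k τ σ U u

/-- `u ∈ 𝓓'^{{σ}}(U)`: continuity for the inductive limit topology of `𝓓^{{σ}}(U)`. -/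
def IsUltradistributionUnion {d : ℕ} (k : UltraType) (σ : ℝ) (U : Set (RSpace d))
    (u : testSpaceUnion k σ U →ₗ[ℂ] ℂ) : Prop :=
  ∀ τ : ℝ, 0 < τ → ContinuousOnStep k τ σ U u

/-- The associated function
`T_{τ,σ,h}(t) = sup_p log (h ^ (p ^ σ) * t ^ p / p ^ (τ p ^ σ))`, `t > 0`. -/
def assocT (τ σ h t : ℝ) : ℝ :=
  ⨆ p : ℕ, Real.log (h ^ ((p : ℝ) ^ σ) * t ^ p / (p : ℝ) ^ (τ * (p : ℝ) ^ σ))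

/-- Open cones with vertex at the origin. -/
def IsOpenCone {d : ℕ} (V : Set (RSpace d)) : Prop :=
  IsOpen V ∧ ∀ y ∈ V, ∀ t : ℝ, 0 < t → t • y ∈ V

/-- The dual cone `Γ⁰`. -/
def dualConeSet {d : ℕ} (Γ : Set (RSpace d)) : Set (RSpace d) :=
  {ξ | ∀ y ∈ Γ, 0 ≤ inner ℝ y ξ}

/-- The point `x + i y`. -/
def complexPoint {d : ℕ} (x y : RSpace d) : CSpace d :=
  WithLp.toLp 2 fun j => (x j : ℂ) + Complex.I * (y j : ℂ)

/-- The domain `Z` of all `z = x + i y` with `x ∈ U`, `y ∈ Γ`, `|y| < γ`. -/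
def wedge {d : ℕ} (U Γ : Set (RSpace d)) (γ : ℝ) : Set (CSpace d) :=
  {z | ∃ x ∈ U, ∃ y ∈ Γ, ‖y‖ < γ ∧ z = complexPoint x y}

/-- `|F(x + i y)| ≤ A exp (T_{τ,σ,H}(1 / |y|))` on the domain `Z`. -/
def AssocGrowth {d : ℕ} (τ σ A H : ℝ) (U Γ : Set (RSpace d)) (γ : ℝ) (F : CSpace d → ℂ) : Prop :=
  ∀ x ∈ U, ∀ y ∈ Γ, y ≠ 0 → ‖y‖ < γ →
    ‖F (complexPoint x y)‖ ≤ A * Real.exp (assocT τ σ H (1 / ‖y‖))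

/-- `|F(x + i y)| ≤ A |y| ^ (- H (log (1/|y|) / log (log (1/|y|))) ^ (1/(σ-1)))` at the points of
`Z` with `|y| < 1 / e`, where the iterated logarithm is positive. -/
def LogGrowth {d : ℕ} (σ A H : ℝ) (U Γ : Set (RSpace d)) (γ : ℝ) (F : CSpace d → ℂ) : Prop :=
  ∀ x ∈ U, ∀ y ∈ Γ, y ≠ 0 → ‖y‖ < γ → ‖y‖ < Real.exp (-1) →
    ‖F (complexPoint x y)‖ ≤ A * ‖y‖ ^
      (-H * (Real.log (1 / ‖y‖) / Real.log (Real.log (1 / ‖y‖))) ^ (1 / (σ - 1)))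

/-- `u = F(x + i Γ 0)`: the functions `F(· + i y)` converge to `u` weakly on the test space `X` as
`y → 0` in `Γ`. -/
def IsBoundaryValue {d : ℕ} (F : CSpace d → ℂ) (Γ : Set (RSpace d))
    {X : Submodule ℂ (RSpace d → ℂ)} (u : X →ₗ[ℂ] ℂ) : Prop :=
  ∀ φ : X, Tendsto (fun y : RSpace d => ∫ x : RSpace d, F (complexPoint x y) * (φ : RSpace d → ℂ) x)
    (𝓝[Γ] 0) (𝓝 (u φ))

/-- The condition `(x₀, ξ₀) ∉ WF_{ρ,σ}(u)`. The cutoff `φ` is taken in `𝓓_{ρ,σ}(U)` and in the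
domain `X` of `u`, so that `φ u` is defined; both conditions are the same if `X = 𝓓_{ρ,σ}(U)`. The
Fourier transform of `φ u` at `ξ` is `u(ψ)` for `ψ(x) = φ(x) exp (- i x · ξ)`. -/
def MicroRegular {d : ℕ} (k : UltraType) (ρ σ : ℝ) (U : Set (RSpace d))
    {X : Submodule ℂ (RSpace d → ℂ)} (u : X →ₗ[ℂ] ℂ) (x₀ ξ₀ : RSpace d) : Prop :=
  ∃ V : Set (RSpace d), IsOpenCone V ∧ ξ₀ ∈ V ∧
    ∃ K : Set (RSpace d), IsCompact K ∧ K ∈ 𝓝 x₀ ∧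
      ∃ φ : X, (φ : RSpace d → ℂ) ∈ testSpace k ρ σ U ∧
        tsupport (φ : RSpace d → ℂ) ⊆ K ∧
        (∀ᶠ x in 𝓝 x₀, (φ : RSpace d → ℂ) x = 1) ∧
        k.quant fun h => ∃ A : ℝ, 0 < A ∧ ∀ ξ ∈ V, ∃ ψ : X,
          (∀ x : RSpace d, (ψ : RSpace d → ℂ) x =
            (φ : RSpace d → ℂ) x * Complex.exp (-Complex.I * ((inner ℝ x ξ : ℝ) : ℂ))) ∧
          ‖u ψ‖ ≤ A * Real.exp (-assocT ρ σ h ‖ξ‖)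

/-- The wave front set `WF_{ρ,σ}(u)`, a subset of `U × (ℝ^d \ {0})`. -/
def waveFront {d : ℕ} (k : UltraType) (ρ σ : ℝ) (U : Set (RSpace d))
    {X : Submodule ℂ (RSpace d → ℂ)} (u : X →ₗ[ℂ] ℂ) : Set (RSpace d × RSpace d) :=
  {p | p.1 ∈ U ∧ p.2 ≠ 0 ∧ ¬ MicroRegular k ρ σ U u p.1 p.2}

/-- `WF^{(σ)}(u)`, the union of all `WF_{τ,σ}(u)`, `τ > 0`. -/
def waveFrontUnion {d : ℕ} (k : UltraType) (σ : ℝ) (U : Set (RSpace d))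
    (u : testSpaceInter k σ U →ₗ[ℂ] ℂ) : Set (RSpace d × RSpace d) :=
  ⋃ τ ∈ Set.Ioi (0 : ℝ), waveFront k τ σ U u

/-- `WF^{{σ}}(u)`, the intersection of all `WF_{τ,σ}(u)`, `τ > 0`. -/
def waveFrontInter {d : ℕ} (k : UltraType) (σ : ℝ) (U : Set (RSpace d))
    (u : testSpaceUnion k σ U →ₗ[ℂ] ℂ) : Set (RSpace d × RSpace d) :=
  ⋂ τ ∈ Set.Ioi (0 : ℝ), waveFront k τ σ U u

end

/-! Since `σ > 1`, the weights `h ^ (n ^ σ) * n ^ (τ n ^ σ)` grow faster than `D ^ n * n! ^ 2` for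
every `D`, whatever `τ, h > 0` are. Three consequences reduce all four statements to one classical
fact about Gevrey order two. Compactly supported Gevrey functions of order two lie in every test
space, so they may serve as cutoffs. The associated function satisfies `T(t) ≤ C + δ √t` for every
`δ > 0`, so a decay `exp (-c √|ξ|)` of the Fourier transform is enough. Each growth hypothesis on
`F` implies `|F(x + iy)| ≤ C exp (δ / |y|)` for every `δ > 0`.

It remains to prove this decay near `ξ₀ ∉ Γ⁰`. Choose `v ∈ Γ` with `v · ξ₀ < 0` and put `G(z) = F(z)
exp (-i z · ξ)`, whose exponential factor has modulus `exp (t v · ξ)` at height `y = t v`. Let `J n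
t` be `(-i)^n` times the integral of `G(x + i t v)` against the `n`-th derivative of the cutoff in
direction `v`. The Cauchy-Riemann equations and integration by parts give `J n' = J (n + 1)`. The
value `J 0 ε` is recovered from heights `ε + s` by Taylor expansion. The order `N` of the expansion
is tied to the height by `s = a / (N + 1)`, as for almost analytic extensions: there the singularity
of `F` costs `2 ^ (N + 1)`, the Gevrey remainder gains a geometric factor, and the factor `exp (-l
s)` with `l = -v · ξ` yields `exp (-√(l a))` after optimization over the order. The bound does not
degenerate as `ε → 0` and passes to the boundary value.

The main lemmas are `exists_pow_mul_factorial_sq_le_gevreyWeight`, `exists_isGevreyTwo_cutoff`,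
`hasDerivAt_integral_complexPoint_smul` and `norm_le_of_gevrey_deriv_bounds`. -/

/-! ### Weights and associated functions compared with Gevrey order two. -/

theorem gevreyWeight_zero {σ : ℝ} (hσ : 1 < σ) (τ h : ℝ) : gevreyWeight τ σ h 0 = 1 := by
  simp [gevreyWeight, Real.zero_rpow (by linarith : σ ≠ 0)]

theorem gevreyWeight_pos {σ h : ℝ} (hσ : 1 < σ) (hh : 0 < h) (τ : ℝ) (n : ℕ) :
    0 < gevreyWeight τ σ h n := by
  rcases Nat.eq_zero_or_pos n with rfl | hn
  · simp [gevreyWeight_zero hσ]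
  · have : (0 : ℝ) < n := by exact_mod_cast hn
    unfold gevreyWeight
    positivity

/-- The weights dominate every Gevrey sequence of order two. -/
theorem exists_pow_mul_factorial_sq_le_gevreyWeight {τ σ h D : ℝ} (hτ : 0 < τ) (hσ : 1 < σ)
    (hh : 0 < h) (hD : 0 < D) :
    ∃ C : ℝ, 0 < C ∧ ∀ n : ℕ, D ^ n * (n.factorial : ℝ) ^ 2 ≤ C * gevreyWeight τ σ h n := by
  have hcast : Tendsto (fun n : ℕ => (n : ℝ)) atTop atTop := tendsto_natCast_atTop_atTop
  have hlog := Real.tendsto_log_atTop.comp hcast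
  have hpow := (tendsto_rpow_atTop (sub_pos.2 hσ)).comp hcast
  have hev : ∀ᶠ n : ℕ in atTop,
      D ^ n * (n.factorial : ℝ) ^ 2 ≤ gevreyWeight τ σ h n := by
    -- Half of `τ log n` absorbs `-log h`. The other half, multiplied by `n ^ (σ - 1)`, exceeds `3
    -- log n ≥ log D + 2 log n`.
    filter_upwards [hlog.eventually_ge_atTop (-Real.log h * (2 / τ)),
      hlog.eventually_ge_atTop (Real.log D), hlog.eventually_ge_atTop 0,
      hpow.eventually_ge_atTop (3 * (2 / τ)), eventually_gt_atTop 0] with n h1 h2 h3 h4 hn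
    have hn' : (0 : ℝ) < n := by exact_mod_cast hn
    simp only [Function.comp_apply] at h1 h2 h3 h4
    have hf : (n.factorial : ℝ) ≤ (n : ℝ) ^ n := by exact_mod_cast Nat.factorial_le_pow n
    refine (mul_le_mul_of_nonneg_left (pow_le_pow_left₀ (by positivity) hf 2)
      (by positivity)).trans ?_
    unfold gevreyWeight
    rw [← Real.log_le_log_iff (by positivity) (by positivity),
      Real.log_mul (by positivity) (by positivity), Real.log_mul (by positivity) (by positivity),
      Real.log_rpow hh, Real.log_rpow hn', Real.log_pow, Real.log_pow, Real.log_pow]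
    have hs : (n : ℝ) ^ σ = n * (n : ℝ) ^ (σ - 1) := by
      rw [← Real.rpow_one_add' hn'.le (by linarith)]
      congr 1
      ring
    rw [hs]
    set L := Real.log n
    set q := (n : ℝ) ^ (σ - 1)
    have hq : 0 ≤ q := by positivity
    have h1' : -Real.log h ≤ τ / 2 * L := by
      have := mul_le_mul_of_nonneg_left h1 (by positivity : 0 ≤ τ / 2)
      have e : τ / 2 * (-Real.log h * (2 / τ)) = -Real.log h := by field_simp
      linarith
    have h4' : 3 ≤ τ / 2 * q := by
      have := mul_le_mul_of_nonneg_left h4 (by positivity : 0 ≤ τ / 2)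
      have e : τ / 2 * (3 * (2 / τ)) = 3 := by field_simp
      linarith
    have h5 : q * (-Real.log h) ≤ q * (τ / 2 * L) := mul_le_mul_of_nonneg_left h1' hq
    have h6 : 3 * L ≤ τ / 2 * q * L := mul_le_mul_of_nonneg_right h4' h3
    have h7 : Real.log D + 2 * L ≤ q * Real.log h + τ * q * L := by linarith
    have h8 := mul_le_mul_of_nonneg_left h7 hn'.le
    push_cast
    linarith
  obtain ⟨N, hN⟩ := eventually_atTop.1 hev
  set r : ℕ → ℝ := fun n => D ^ n * (n.factorial : ℝ) ^ 2 / gevreyWeight τ σ h n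
  have hr : ∀ n, 0 ≤ r n := fun n => by
    have := gevreyWeight_pos hσ hh τ n
    positivity
  refine ⟨1 + ∑ n ∈ Finset.range N, r n,
    add_pos_of_pos_of_nonneg one_pos (Finset.sum_nonneg fun n _ => hr n), fun n => ?_⟩
  have hw := gevreyWeight_pos hσ hh τ n
  have hsum : 0 ≤ ∑ n ∈ Finset.range N, r n := Finset.sum_nonneg fun n _ => hr n
  rcases le_or_gt N n with hn | hn
  · refine (hN n hn).trans ?_
    nlinarith
  · rw [← div_le_iff₀ hw]
    have : r n ≤ ∑ n ∈ Finset.range N, r n :=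
      Finset.single_le_sum (fun n _ => hr n) (Finset.mem_range.2 hn)
    linarith

theorem cast_factorial_two_mul_le (n : ℕ) :
    ((2 * n).factorial : ℝ) ≤ 4 ^ n * (n.factorial : ℝ) ^ 2 := by
  have h1 := Nat.choose_mul_factorial_mul_factorial (n := 2 * n) (k := n) (by omega)
  have h2 : (2 * n).choose n ≤ 4 ^ n := by
    calc (2 * n).choose n ≤ 2 ^ (2 * n) := Nat.choose_le_two_pow _ _
      _ = 4 ^ n := by rw [pow_mul]; norm_num
  rw [show 2 * n - n = n by omega] at h1
  have h3 : (2 * n).factorial ≤ 4 ^ n * n.factorial ^ 2 := by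
    rw [← h1, mul_assoc, ← sq]
    exact Nat.mul_le_mul_right _ h2
  exact_mod_cast h3

/-- The associated function grows more slowly than every multiple of the square root. -/
theorem exists_assocT_le_add_mul_sqrt {τ σ h δ : ℝ} (hτ : 0 < τ) (hσ : 1 < σ) (hh : 0 < h)
    (hδ : 0 < δ) : ∃ C : ℝ, ∀ t : ℝ, 0 < t → assocT τ σ h t ≤ C + δ * √t := by
  -- With `h⁻¹` in place of `h`, the terms of the supremum are `log (t ^ p / weight)`. The constant
  -- `4 / δ ^ 2` collects `δ ^ (-2p)` and the `4 ^ p` from `(2p)! ≤ 4 ^ p * p! ^ 2`.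
  obtain ⟨C, hC, hb⟩ := exists_pow_mul_factorial_sq_le_gevreyWeight (D := 4 / δ ^ 2) hτ hσ
    (inv_pos.2 hh) (by positivity)
  refine ⟨Real.log C, fun t ht => ciSup_le fun p => ?_⟩
  have hw := gevreyWeight_pos hσ (inv_pos.2 hh) τ p
  have e : h ^ ((p : ℝ) ^ σ) * t ^ p / (p : ℝ) ^ (τ * (p : ℝ) ^ σ) =
      t ^ p / gevreyWeight τ σ h⁻¹ p := by
    unfold gevreyWeight
    rw [Real.inv_rpow hh.le]
    have : h ^ ((p : ℝ) ^ σ) ≠ 0 := by positivity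
    field_simp
  rw [e, Real.log_le_iff_le_exp (by positivity), Real.exp_add, Real.exp_log hC, div_le_iff₀ hw]
  -- Only the term of index `2p` of the exponential series is kept, because `√t ^ (2p) = t ^ p`.
  have h1 := Real.pow_div_factorial_le_exp (δ * √t) (by positivity) (2 * p)
  rw [div_le_iff₀ (by positivity), mul_pow, pow_mul (√t), Real.sq_sqrt ht.le] at h1
  have h2 := cast_factorial_two_mul_le p
  have h3 := h1.trans (mul_le_mul_of_nonneg_left h2 (Real.exp_pos _).le)
  have h4 := mul_le_mul_of_nonneg_right (hb p) (Real.exp_pos (δ * √t)).le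
  calc t ^ p = (δ ^ (2 * p) * t ^ p) / δ ^ (2 * p) := by field_simp
    _ ≤ Real.exp (δ * √t) * (4 ^ p * (p.factorial : ℝ) ^ 2) / δ ^ (2 * p) :=
        div_le_div_of_nonneg_right h3 (by positivity)
    _ = ((4 / δ ^ 2) ^ p * (p.factorial : ℝ) ^ 2) * Real.exp (δ * √t) := by
        rw [div_pow, ← pow_mul]
        ring
    _ ≤ _ := h4
    _ = _ := by ring

/-! ### Growth at the edge. -/

/-- Growth at the edge that is weaker than `exp (δ / |y|)` for every `δ > 0`. -/
def SubexponentialGrowth {d : ℕ} (U Γ : Set (RSpace d)) (F : CSpace d → ℂ) : Prop :=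
  ∃ r : ℝ, 0 < r ∧ ∀ δ : ℝ, 0 < δ → ∃ C : ℝ, 0 < C ∧ ∀ x ∈ U, ∀ y ∈ Γ, y ≠ 0 → ‖y‖ < r →
    ‖F (complexPoint x y)‖ ≤ C * Real.exp (δ / ‖y‖)

theorem AssocGrowth.subexponentialGrowth {d : ℕ} {τ σ A H γ : ℝ} {U Γ : Set (RSpace d)}
    {F : CSpace d → ℂ} (hτ : 0 < τ) (hσ : 1 < σ) (hA : 0 < A) (hH : 0 < H) (hγ : 0 < γ)
    (hF : AssocGrowth τ σ A H U Γ γ F) : SubexponentialGrowth U Γ F := by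
  refine ⟨min γ 1, by positivity, fun δ hδ => ?_⟩
  obtain ⟨C, hC⟩ := exists_assocT_le_add_mul_sqrt hτ hσ hH hδ
  refine ⟨A * Real.exp C, by positivity, fun x hx y hy h0 hyr => ?_⟩
  have hy0 : 0 < ‖y‖ := norm_pos_iff.2 h0
  refine (hF x hx y hy h0 (hyr.trans_le (min_le_left _ _))).trans ?_
  rw [mul_assoc, ← Real.exp_add]
  gcongr
  refine (hC _ (by positivity)).trans ?_
  have h1 : 1 ≤ 1 / ‖y‖ := by
    rw [le_div_iff₀ hy0]
    linarith [hyr.trans_le (min_le_right γ 1)]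
  have h2 : √(1 / ‖y‖) ≤ 1 / ‖y‖ := by
    rw [Real.sqrt_le_left (by positivity)]
    nlinarith
  rw [div_eq_mul_one_div δ]
  gcongr

/-- With `L = log (1 / |y|)` the logarithm of the bound is at most a constant plus `H L ^ (1 + 1 /
(σ - 1))`, a power of `L`, whereas `δ / |y| = δ exp L`. -/
theorem LogGrowth.subexponentialGrowth {d : ℕ} {σ A H γ : ℝ} {U Γ : Set (RSpace d)}
    {F : CSpace d → ℂ} (hσ : 1 < σ) (hA : 0 < A) (hH : 0 < H) (hγ : 0 < γ)
    (hF : LogGrowth σ A H U Γ γ F) : SubexponentialGrowth U Γ F := by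
  -- The radius `exp (-e)` forces `L ≥ e`, hence `log L ≥ 1`, so that the division by `log L` can be
  -- dropped.
  refine ⟨min γ (Real.exp (-Real.exp 1)), by positivity, fun δ hδ => ?_⟩
  set s := 1 / (σ - 1) with hs
  have hs0 : 0 < s := one_div_pos.2 (sub_pos.2 hσ)
  have hlim : ∀ᶠ L : ℝ in atTop, H * L ^ (1 + s) ≤ δ * Real.exp L := by
    have h1 := (isLittleO_rpow_exp_atTop (1 + s)).bound (div_pos hδ hH)
    filter_upwards [h1, eventually_ge_atTop 0] with L hL hL0
    rw [Real.norm_of_nonneg (by positivity), Real.norm_of_nonneg (by positivity)] at hL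
    calc H * L ^ (1 + s) ≤ H * (δ / H * Real.exp L) := by gcongr
      _ = _ := by field_simp
  obtain ⟨L₀, hL₀⟩ := eventually_atTop.1 hlim
  refine ⟨A * Real.exp (H * |L₀| ^ (1 + s)), by positivity, fun x hx y hy h0 hyr => ?_⟩
  have hy0 : 0 < ‖y‖ := norm_pos_iff.2 h0
  have hyL : ‖y‖ < Real.exp (-Real.exp 1) := hyr.trans_le (min_le_right _ _)
  have he : 1 ≤ Real.exp 1 := by linarith [Real.add_one_le_exp (1 : ℝ)]
  refine (hF x hx y hy h0 (hyr.trans_le (min_le_left _ _))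
    (hyL.trans_le (Real.exp_le_exp.2 (by linarith)))).trans ?_
  set L := Real.log (1 / ‖y‖) with hL
  have hLy : Real.log ‖y‖ = -L := by rw [hL, one_div, Real.log_inv, neg_neg]
  have hLL : Real.exp 1 ≤ L := by
    have := Real.log_le_log hy0 hyL.le
    rw [Real.log_exp, hLy] at this
    linarith
  have hL1 : 0 < L := by linarith
  have hlogL : 1 ≤ Real.log L := (Real.le_log_iff_exp_le hL1).2 hLL
  have hδL : δ * Real.exp L = δ / ‖y‖ := by
    rw [hL, Real.exp_log (by positivity)]
    ring
  rw [Real.rpow_def_of_pos hy0, hLy, mul_assoc, ← Real.exp_add]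
  gcongr
  calc -L * (-H * (L / Real.log L) ^ s) = H * (L * (L / Real.log L) ^ s) := by ring
    _ ≤ H * (L * L ^ s) := by
        gcongr
        exact div_le_self hL1.le hlogL
    _ = H * L ^ (1 + s) := by rw [Real.rpow_add hL1, Real.rpow_one]
    _ ≤ H * |L₀| ^ (1 + s) + δ * Real.exp L := by
        rcases le_total L₀ L with h | h
        · have : 0 ≤ H * |L₀| ^ (1 + s) := by positivity
          linarith [hL₀ L h]
        · have h2 : H * L ^ (1 + s) ≤ H * |L₀| ^ (1 + s) := by
            gcongr
            exact h.trans (le_abs_self _)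
          have : 0 < δ * Real.exp L := by positivity
          linarith
    _ = _ := by rw [hδL]

/-! ### Calculus of Gevrey functions of order two. -/

/-- Smooth functions whose derivatives are bounded by a Gevrey sequence of order two. -/
def IsGevreyTwo {E F : Type*} [NormedAddCommGroup E] [NormedSpace ℝ E] [NormedAddCommGroup F]
    [NormedSpace ℝ F] (f : E → F) : Prop :=
  ContDiff ℝ ∞ f ∧ ∃ D : ℝ, 0 < D ∧ ∀ (n : ℕ) (x : E),
    ‖iteratedFDeriv ℝ n f x‖ ≤ D ^ (n + 1) * (n.factorial : ℝ) ^ 2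

namespace IsGevreyTwo

variable {E F G : Type*} [NormedAddCommGroup E] [NormedSpace ℝ E] [NormedAddCommGroup F]
  [NormedSpace ℝ F] [NormedAddCommGroup G] [NormedSpace ℝ G]

theorem of_bound {f : E → F} (hf : ContDiff ℝ ∞ f) {A D : ℝ}
    (h : ∀ (n : ℕ) (x : E), ‖iteratedFDeriv ℝ n f x‖ ≤ A * D ^ n * (n.factorial : ℝ) ^ 2) :
    IsGevreyTwo f := by
  refine ⟨hf, max 1 (max |A| |D|), by positivity, fun n x => (h n x).trans ?_⟩
  have h1 : |A| ≤ max 1 (max |A| |D|) := (le_max_left _ _).trans (le_max_right _ _)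
  have h2 : |D| ≤ max 1 (max |A| |D|) := (le_max_right _ _).trans (le_max_right _ _)
  gcongr
  calc A * D ^ n ≤ |A * D ^ n| := le_abs_self _
    _ = |A| * |D| ^ n := by rw [abs_mul, abs_pow]
    _ ≤ max 1 (max |A| |D|) * max 1 (max |A| |D|) ^ n := by gcongr
    _ = _ := by ring

theorem const (c : F) : IsGevreyTwo (fun _ : E => c) := by
  refine of_bound contDiff_const (A := ‖c‖) (D := 1) fun n x => ?_
  rcases Nat.eq_zero_or_pos n with rfl | hn
  · simp
  · rw [iteratedFDeriv_const_of_ne hn.ne']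
    simp only [Pi.zero_apply, norm_zero]
    positivity

/-- In the Leibniz formula one factor `i! (n - i)!` combines with the binomial coefficient to `n!`,
the other is at most `n!`, and the `n + 1` summands cost `2 ^ n`. -/
theorem mul {A : Type*} [NormedRing A] [NormedAlgebra ℝ A] {f g : E → A} (hf : IsGevreyTwo f)
    (hg : IsGevreyTwo g) : IsGevreyTwo (fun x => f x * g x) := by
  obtain ⟨hf, D, hD, hfD⟩ := hf
  obtain ⟨hg, D', hD', hgD⟩ := hg
  refine of_bound (hf.mul hg) (A := D * D') (D := 2 * (D + D')) fun n x => ?_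
  refine (norm_iteratedFDeriv_mul_le hf hg x (by exact_mod_cast le_top)).trans ?_
  have key : ∀ i ∈ Finset.range (n + 1), (n.choose i : ℝ) * ‖iteratedFDeriv ℝ i f x‖ *
      ‖iteratedFDeriv ℝ (n - i) g x‖ ≤ D * D' * (D + D') ^ n * (n.factorial : ℝ) ^ 2 := by
    intro i hi
    have hin : i ≤ n := Nat.lt_succ_iff.1 (Finset.mem_range.1 hi)
    have h1 : (n.choose i : ℝ) * i.factorial * (n - i).factorial = n.factorial := by
      exact_mod_cast Nat.choose_mul_factorial_mul_factorial hin
    have h2 : (i.factorial : ℝ) * (n - i).factorial ≤ n.factorial := by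
      exact_mod_cast Nat.le_of_dvd n.factorial_pos (Nat.factorial_mul_factorial_dvd_factorial hin)
    have h3 : D ^ i * D' ^ (n - i) ≤ (D + D') ^ n := by
      calc D ^ i * D' ^ (n - i) ≤ (D + D') ^ i * (D + D') ^ (n - i) := by
            gcongr <;> linarith
        _ = _ := by rw [← pow_add, Nat.add_sub_cancel' hin]
    calc _ ≤ (n.choose i : ℝ) * (D ^ (i + 1) * (i.factorial : ℝ) ^ 2) *
          (D' ^ (n - i + 1) * ((n - i).factorial : ℝ) ^ 2) := by
          gcongr
          · exact hfD i x
          · exact hgD (n - i) x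
      _ = D * D' * (D ^ i * D' ^ (n - i)) * ((n.choose i : ℝ) * i.factorial * (n - i).factorial) *
          ((i.factorial : ℝ) * (n - i).factorial) := by ring
      _ ≤ D * D' * (D + D') ^ n * n.factorial * n.factorial := by
          rw [h1]
          gcongr
      _ = _ := by ring
  refine (Finset.sum_le_sum key).trans ?_
  rw [Finset.sum_const, Finset.card_range, nsmul_eq_mul, mul_pow]
  have h4 : ((n + 1 : ℕ) : ℝ) ≤ 2 ^ n := by exact_mod_cast n.lt_two_pow_self
  calc _ ≤ 2 ^ n * (D * D' * (D + D') ^ n * (n.factorial : ℝ) ^ 2) := by gcongr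
    _ = _ := by ring

theorem prod {ι A : Type*} [NormedCommRing A] [NormedAlgebra ℝ A] (s : Finset ι) {f : ι → E → A}
    (hf : ∀ i ∈ s, IsGevreyTwo (f i)) : IsGevreyTwo (fun x => ∏ i ∈ s, f i x) := by
  classical
  induction s using Finset.induction_on with
  | empty => simpa using const (E := E) (1 : A)
  | insert a s ha ih =>
    simp only [Finset.prod_insert ha]
    exact (hf a (Finset.mem_insert_self a s)).mul
      (ih fun i hi => hf i (Finset.mem_insert_of_mem hi))

theorem comp_clm {f : F → G} (hf : IsGevreyTwo f) (L : E →L[ℝ] F) :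
    IsGevreyTwo (fun x => f (L x)) := by
  obtain ⟨hf, D, hD, hfD⟩ := hf
  refine of_bound (hf.comp L.contDiff) (A := D) (D := D * ‖L‖) fun n x => ?_
  have := L.iteratedFDeriv_comp_right hf x (i := n) (by exact_mod_cast le_top)
  rw [Function.comp_def] at this
  rw [this]
  refine (ContinuousMultilinearMap.norm_compContinuousLinearMap_le _ _).trans ?_
  rw [Finset.prod_const, Finset.card_univ, Fintype.card_fin]
  calc _ ≤ D ^ (n + 1) * (n.factorial : ℝ) ^ 2 * ‖L‖ ^ n := by
        gcongr
        exact hfD n _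
    _ = _ := by ring

theorem comp_add_right {f : E → F} (hf : IsGevreyTwo f) (a : E) :
    IsGevreyTwo (fun x => f (x + a)) := by
  obtain ⟨hf, D, hD, hfD⟩ := hf
  refine ⟨hf.comp (contDiff_id.add contDiff_const), D, hD, fun n x => ?_⟩
  rw [iteratedFDeriv_comp_add_right]
  exact hfD n _

theorem ofReal {f : E → ℝ} (hf : IsGevreyTwo f) : IsGevreyTwo (fun x => (f x : ℂ)) := by
  obtain ⟨hf, D, hD, hfD⟩ := hf
  refine ⟨Complex.ofRealCLM.contDiff.comp hf, D, hD, fun n x => ?_⟩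
  have := Complex.ofRealLI.norm_iteratedFDeriv_comp_left (f := f) (x := x) hf.contDiffAt (i := n)
    (by exact_mod_cast le_top)
  exact this.trans_le (hfD n x)

theorem of_iteratedDeriv {f : ℝ → F} (hf : ContDiff ℝ ∞ f) {A D : ℝ}
    (h : ∀ (n : ℕ) (x : ℝ), ‖iteratedDeriv n f x‖ ≤ A * D ^ n * (n.factorial : ℝ) ^ 2) :
    IsGevreyTwo f :=
  of_bound hf fun n x => norm_iteratedFDeriv_eq_norm_iteratedDeriv.trans_le (h n x)

/-- A bounded primitive of a Gevrey function is a Gevrey function. -/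
theorem of_hasDerivAt {f f' : ℝ → F} (hf : ∀ x, HasDerivAt f (f' x) x) {B : ℝ}
    (hB : ∀ x, ‖f x‖ ≤ B) (hf' : IsGevreyTwo f') : IsGevreyTwo f := by
  obtain ⟨hc, D, hD, hfD⟩ := hf'
  have hd : deriv f = f' := funext fun x => (hf x).deriv
  refine of_iteratedDeriv (A := max B 1) (D := D + 1)
    (contDiff_infty_iff_deriv.2 ⟨fun x => (hf x).differentiableAt, hd ▸ hc⟩) fun n x => ?_
  cases n with
  | zero => simpa using Or.inl (hB x)
  | succ n =>
    rw [iteratedDeriv_succ', hd, ← norm_iteratedFDeriv_eq_norm_iteratedDeriv]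
    refine (hfD n x).trans ?_
    have h1 : (n.factorial : ℝ) ≤ (n + 1).factorial := by
      exact_mod_cast Nat.factorial_le n.le_succ
    calc D ^ (n + 1) * (n.factorial : ℝ) ^ 2
        ≤ 1 * (D + 1) ^ (n + 1) * ((n + 1).factorial : ℝ) ^ 2 := by
          rw [one_mul]
          gcongr
          linarith
      _ ≤ _ := by
          gcongr
          exact le_max_right _ _

end IsGevreyTwo

/-! ### Cutoff functions of Gevrey order two. -/

/-- For `g k = x ^ (-k) exp (-1/x)` one has `g k' = g (k + 2) - k g (k + 1)`: each derivative raises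
`k` by at most two and doubles the bound. The induction must run over all `k`; it starts from `s ^ k
exp (-s) ≤ k!`. For `k = 0` the factor `(2n)!` is what gives order two. -/
theorem norm_iteratedDeriv_inv_pow_mul_expNegInvGlue_le (n : ℕ) : ∀ (k : ℕ) (x : ℝ),
    ‖iteratedDeriv n (fun x => (Polynomial.X ^ k : Polynomial ℝ).eval x⁻¹ * expNegInvGlue x) x‖ ≤
      2 ^ n * (k + 2 * n).factorial := by
  induction n with
  | zero =>
    intro k x
    simp only [iteratedDeriv_zero, Polynomial.eval_pow, Polynomial.eval_X, pow_zero, one_mul,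
      mul_zero, add_zero]
    rcases le_or_gt x 0 with hx | hx
    · rw [expNegInvGlue.zero_of_nonpos hx]
      simp
    · have h1 := Real.pow_div_factorial_le_exp x⁻¹ (by positivity) k
      rw [div_le_iff₀ (by positivity)] at h1
      rw [Real.norm_of_nonneg (mul_nonneg (by positivity) (expNegInvGlue.nonneg x)), expNegInvGlue,
        if_neg hx.not_ge, Real.exp_neg, ← div_eq_mul_inv, div_le_iff₀ (by positivity), mul_comm]
      exact h1
  | succ n ih =>
    intro k x
    set g : ℕ → ℝ → ℝ := fun k x =>
      (Polynomial.X ^ k : Polynomial ℝ).eval x⁻¹ * expNegInvGlue x with hg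
    have hsm : ∀ k, ContDiff ℝ n (g k) := fun k =>
      expNegInvGlue.contDiff_polynomial_eval_inv_mul (n := (n : ℕ∞)) _
    have hd : deriv (g k) = fun x => g (k + 2) x - (k : ℝ) * g (k + 1) x := by
      funext x
      rw [(expNegInvGlue.hasDerivAt_polynomial_eval_inv_mul (Polynomial.X ^ k) x).deriv]
      rcases k with _ | k
      · simp [hg]
      · simp [hg]
        ring
    rw [iteratedDeriv_succ', hd]
    have e : iteratedDeriv n (fun x => g (k + 2) x - (k : ℝ) * g (k + 1) x) x =
        iteratedDeriv n (g (k + 2)) x - (k : ℝ) * iteratedDeriv n (g (k + 1)) x := by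
      rw [iteratedDeriv_fun_sub (hsm _).contDiffAt (contDiffAt_const.mul (hsm _).contDiffAt),
        iteratedDeriv_const_mul_field]
    rw [e]
    refine (norm_sub_le _ _).trans ?_
    rw [norm_mul, Real.norm_natCast]
    have h1 := ih (k + 2) x
    have h2 := ih (k + 1) x
    have h3 : (k : ℝ) * (k + 1 + 2 * n).factorial ≤ (k + 2 * (n + 1)).factorial := by
      rw [show k + 2 * (n + 1) = (k + 1 + 2 * n) + 1 by ring, Nat.factorial_succ]
      push_cast
      gcongr
      linarith
    rw [show k + 2 + 2 * n = k + 2 * (n + 1) by ring] at h1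
    calc _ ≤ 2 ^ n * ((k + 2 * (n + 1)).factorial : ℝ) +
          k * (2 ^ n * ((k + 1 + 2 * n).factorial : ℝ)) := by gcongr
      _ = 2 ^ n * ((k + 2 * (n + 1)).factorial : ℝ) +
          2 ^ n * (k * ((k + 1 + 2 * n).factorial : ℝ)) := by ring
      _ ≤ 2 ^ n * ((k + 2 * (n + 1)).factorial : ℝ) +
          2 ^ n * ((k + 2 * (n + 1)).factorial : ℝ) := by gcongr
      _ = _ := by ring

theorem isGevreyTwo_expNegInvGlue : IsGevreyTwo expNegInvGlue := by
  refine IsGevreyTwo.of_iteratedDeriv (A := 1) (D := 8) expNegInvGlue.contDiff fun n x => ?_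
  have h := norm_iteratedDeriv_inv_pow_mul_expNegInvGlue_le n 0 x
  simp only [pow_zero, Polynomial.eval_one, one_mul, zero_add] at h
  refine h.trans ?_
  calc (2 : ℝ) ^ n * (2 * n).factorial ≤ 2 ^ n * (4 ^ n * (n.factorial : ℝ) ^ 2) := by
        gcongr
        exact cast_factorial_two_mul_le n
    _ = _ := by
        rw [← mul_assoc, ← mul_pow]
        norm_num

theorem isGevreyTwo_exp_mul_I : IsGevreyTwo (fun t : ℝ => Complex.exp (-Complex.I * t)) := by
  refine IsGevreyTwo.of_iteratedDeriv (A := 1) (D := 1)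
    ((contDiff_const.mul Complex.ofRealCLM.contDiff).cexp) fun n x => ?_
  have h : ∀ n : ℕ, iteratedDeriv n (fun t : ℝ => Complex.exp (-Complex.I * t)) =
      fun t : ℝ => (-Complex.I) ^ n * Complex.exp (-Complex.I * t) := by
    intro n
    induction n with
    | zero => simp
    | succ n ih =>
      rw [iteratedDeriv_succ, ih]
      funext t
      have h1 : HasDerivAt (fun t : ℝ => -Complex.I * (t : ℂ)) (-Complex.I) t := by
        simpa using (Complex.ofRealCLM.hasDerivAt (x := t)).const_mul (-Complex.I)
      rw [(h1.cexp.const_mul _).deriv]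
      ring
  rw [h, norm_mul, norm_pow, norm_neg, Complex.norm_I, Complex.norm_exp]
  simpa using Nat.one_le_iff_ne_zero.2 n.factorial_ne_zero

/-- A Gevrey function that is `0` on `(-∞, 0]` and `1` on `[1, ∞)`. -/
theorem exists_isGevreyTwo_step : ∃ S : ℝ → ℝ, IsGevreyTwo S ∧ (∀ x ≤ 0, S x = 0) ∧
    ∀ x, 1 ≤ x → S x = 1 := by
  -- A bump on `(0, 1)`; its primitive, normalized by the total mass, is the required step.
  set b : ℝ → ℝ := fun x => expNegInvGlue x * expNegInvGlue (1 - x) with hb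
  have hbG : IsGevreyTwo b := by
    refine isGevreyTwo_expNegInvGlue.mul ?_
    simpa [sub_eq_neg_add] using
      (isGevreyTwo_expNegInvGlue.comp_add_right 1).comp_clm (-ContinuousLinearMap.id ℝ ℝ)
  have hbc : Continuous b := hbG.1.continuous
  have hb0 : ∀ x, 0 ≤ b x := fun x => mul_nonneg (expNegInvGlue.nonneg _) (expNegInvGlue.nonneg _)
  have hbl : ∀ x ≤ 0, b x = 0 := fun x hx => by simp [hb, expNegInvGlue.zero_of_nonpos hx]
  have hbr : ∀ x, 1 ≤ x → b x = 0 := fun x hx => by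
    simp [hb, expNegInvGlue.zero_of_nonpos (sub_nonpos.2 hx)]
  have hi : ∀ x y, IntervalIntegrable b volume x y := fun x y => hbc.intervalIntegrable x y
  set c := ∫ x in (0 : ℝ)..1, b x
  have hc : 0 < c := intervalIntegral.intervalIntegral_pos_of_pos_on (hi 0 1)
    (fun x hx => mul_pos (expNegInvGlue.pos_of_pos hx.1)
      (expNegInvGlue.pos_of_pos (sub_pos.2 hx.2))) one_pos
  set P : ℝ → ℝ := fun x => ∫ t in (0 : ℝ)..x, b t
  have hPl : ∀ x ≤ 0, P x = 0 := fun x hx => by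
    refine intervalIntegral.integral_zero_ae (ae_of_all _ fun t ht => hbl t ?_)
    rw [Set.uIoc_of_ge hx] at ht
    exact ht.2
  have hPr : ∀ x, 1 ≤ x → P x = c := fun x hx => by
    have h1 : ∫ t in (1 : ℝ)..x, b t = 0 := by
      refine intervalIntegral.integral_zero_ae (ae_of_all _ fun t ht => hbr t ?_)
      rw [Set.uIoc_of_le hx] at ht
      exact ht.1.le
    have h2 := intervalIntegral.integral_add_adjacent_intervals (hi 0 1) (hi 1 x)
    rw [h1, add_zero] at h2
    exact h2.symm
  have hd : ∀ x, HasDerivAt P (b x) x := fun x =>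
    intervalIntegral.integral_hasDerivAt_right (hi 0 x)
      hbc.stronglyMeasurable.stronglyMeasurableAtFilter hbc.continuousAt
  have hmono : Monotone P := monotone_of_hasDerivAt_nonneg hd hb0
  have hPG : IsGevreyTwo P := by
    refine IsGevreyTwo.of_hasDerivAt hd (B := c) (fun x => ?_) hbG
    have h1 : 0 ≤ P x := by
      rw [← hPl (min x 0) (min_le_right _ _)]
      exact hmono (min_le_left _ _)
    have h2 : P x ≤ c := by
      rw [← hPr (max x 1) (le_max_right _ _)]
      exact hmono (le_max_left _ _)
    rwa [Real.norm_of_nonneg h1]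
  refine ⟨fun x => c⁻¹ * P x, (IsGevreyTwo.const _).mul hPG, fun x hx => ?_, fun x hx => ?_⟩
  · simp [hPl x hx]
  · simp [hPr x hx, hc.ne']

/-- Gevrey cutoff functions with support in a given neighbourhood. -/
theorem exists_isGevreyTwo_cutoff {d : ℕ} (x₀ : RSpace d) {U : Set (RSpace d)} (hU : U ∈ 𝓝 x₀) :
    ∃ φ : RSpace d → ℂ, IsGevreyTwo φ ∧ HasCompactSupport φ ∧ tsupport φ ⊆ U ∧
      ∀ᶠ x in 𝓝 x₀, φ x = 1 := by
  obtain ⟨S, hS, hS0, hS1⟩ := exists_isGevreyTwo_step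
  obtain ⟨R, hR, hRU⟩ := Metric.nhds_basis_closedBall.mem_iff.1 hU
  set θ : ℝ → ℝ := fun t => S (t + 2) * S (-t + 2) with hθ
  have hθG : IsGevreyTwo θ := by
    refine (hS.comp_add_right 2).mul ?_
    exact (hS.comp_add_right 2).comp_clm (-ContinuousLinearMap.id ℝ ℝ)
  have hθ1 : ∀ t, |t| ≤ 1 → θ t = 1 := fun t ht => by
    rw [abs_le] at ht
    simp only [hθ]
    rw [hS1 _ (by linarith), hS1 _ (by linarith), one_mul]
  have hθ0 : ∀ t, 2 ≤ |t| → θ t = 0 := fun t ht => by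
    rcases le_abs.1 ht with h | h
    · simp [hθ, hS0 (-t + 2) (by linarith)]
    · simp [hθ, hS0 (t + 2) (by linarith)]
  -- The support lies in a cube of half side `2r`, whose points have norm at most `2rd ≤ R`. Using
  -- `d + 1` keeps `r` meaningful for `d = 0`.
  set r : ℝ := R / (2 * (d + 1)) with hr
  have hr0 : 0 < r := by positivity
  set χ : RSpace d → ℝ := fun x => ∏ j : Fin d, θ (r⁻¹ * (x + -x₀) j) with hχ
  have hχG : IsGevreyTwo χ := by
    refine IsGevreyTwo.prod Finset.univ fun j _ => ?_
    exact (hθG.comp_clm (r⁻¹ • (EuclideanSpace.proj j : RSpace d →L[ℝ] ℝ))).comp_add_right (-x₀)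
  have hsupp : tsupport χ ⊆ Metric.closedBall x₀ R := by
    refine closure_minimal (fun x hx => ?_) Metric.isClosed_closedBall
    have hj : ∀ j, |(x + -x₀) j| ≤ 2 * r := fun j => by
      by_contra! hcon
      refine hx (Finset.prod_eq_zero (Finset.mem_univ j) (hθ0 _ ?_))
      rw [abs_mul, abs_of_pos (inv_pos.2 hr0), inv_mul_eq_div, le_div_iff₀ hr0]
      exact hcon.le
    rw [Metric.mem_closedBall, dist_eq_norm, sub_eq_add_neg]
    have h1 : ‖x + -x₀‖ ≤ ∑ j : Fin d, ‖(x + -x₀) j‖ := by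
      have h2 := (EuclideanSpace.basisFun (Fin d) ℝ).sum_repr (x + -x₀)
      calc ‖x + -x₀‖ = ‖∑ j : Fin d, (x + -x₀) j • EuclideanSpace.basisFun (Fin d) ℝ j‖ := by
            conv_lhs => rw [← h2]
            rfl
        _ ≤ ∑ j : Fin d, ‖(x + -x₀) j • EuclideanSpace.basisFun (Fin d) ℝ j‖ := norm_sum_le _ _
        _ = _ := by
            refine Finset.sum_congr rfl fun j _ => ?_
            rw [norm_smul, OrthonormalBasis.norm_eq_one, mul_one]
    calc ‖x + -x₀‖ ≤ ∑ j : Fin d, ‖(x + -x₀) j‖ := h1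
      _ ≤ ∑ _j : Fin d, 2 * r := Finset.sum_le_sum fun j _ => hj j
      _ = d * (2 * r) := by simp
      _ ≤ (d + 1) * (2 * r) := by gcongr; linarith
      _ = R := by rw [hr]; field_simp
  have hsuppC : tsupport (fun x => (χ x : ℂ)) ⊆ tsupport χ := by
    refine closure_mono fun x hx => ?_
    simpa using hx
  refine ⟨fun x => (χ x : ℂ), hχG.ofReal, ?_, hsuppC.trans (hsupp.trans hRU), ?_⟩
  · exact HasCompactSupport.of_support_subset_isCompact (isCompact_closedBall x₀ R)
      ((subset_tsupport _).trans (hsuppC.trans hsupp))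
  · filter_upwards [Metric.closedBall_mem_nhds x₀ hr0] with x hx
    rw [Metric.mem_closedBall, dist_eq_norm, sub_eq_add_neg] at hx
    have : χ x = 1 := by
      refine Finset.prod_eq_one fun j _ => hθ1 _ ?_
      rw [abs_mul, abs_of_pos (inv_pos.2 hr0), inv_mul_eq_div, div_le_one hr0]
      exact (PiLp.norm_apply_le (x + -x₀) j).trans hx
    rw [this, Complex.ofReal_one]

/-- The Gevrey constant depends on `ξ`. This is harmless, since the result only serves to show that
`u` may be applied to the product. -/
theorem IsGevreyTwo.mul_exp {d : ℕ} {φ : RSpace d → ℂ} (hφ : IsGevreyTwo φ) (ξ : RSpace d) :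
    IsGevreyTwo (fun x => φ x * Complex.exp (-Complex.I * ((inner ℝ x ξ : ℝ) : ℂ))) := by
  refine hφ.mul ?_
  have h := isGevreyTwo_exp_mul_I.comp_clm (innerSL ℝ ξ)
  simp only [innerSL_apply_apply] at h
  simpa only [real_inner_comm] using h

/-- Compactly supported Gevrey functions belong to all test spaces. -/
theorem IsGevreyTwo.mem_testSpace {d : ℕ} {φ : RSpace d → ℂ} (hφ : IsGevreyTwo φ)
    (hc : HasCompactSupport φ) {U : Set (RSpace d)} (hU : tsupport φ ⊆ U) (k : UltraType)
    {τ σ : ℝ} (hτ : 0 < τ) (hσ : 1 < σ) : φ ∈ testSpace k τ σ U := by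
  obtain ⟨hs, D, hD, hφD⟩ := hφ
  have key : ∀ h : ℝ, 0 < h → ultraNorm τ σ h (tsupport φ) φ < ⊤ := by
    intro h hh
    obtain ⟨C, hC, hb⟩ := exists_pow_mul_factorial_sq_le_gevreyWeight hτ hσ hh hD
    refine lt_of_le_of_lt ?_ (ENNReal.ofReal_lt_top (r := D * C))
    refine iSup₂_le fun n i => iSup₂_le fun x _ => ENNReal.ofReal_le_ofReal ?_
    rw [div_le_iff₀ (gevreyWeight_pos hσ hh τ n)]
    have h1 : ‖partialD i φ x‖ ≤ ‖iteratedFDeriv ℝ n φ x‖ := by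
      refine (ContinuousMultilinearMap.le_opNorm _ _).trans ?_
      simp
    calc ‖partialD i φ x‖ ≤ D ^ (n + 1) * (n.factorial : ℝ) ^ 2 := h1.trans (hφD n x)
      _ = D * (D ^ n * (n.factorial : ℝ) ^ 2) := by ring
      _ ≤ D * (C * gevreyWeight τ σ h n) := mul_le_mul_of_nonneg_left (hb n) hD.le
      _ = _ := by ring
  refine ⟨hs, tsupport φ, hc, hU, le_rfl, ?_⟩
  cases k
  · exact key
  · exact ⟨1, one_pos, key 1 one_pos⟩

/-! ### Differentiation of pairings along rays of the cone. -/

/-- The inclusion of `ℝ^d` into `ℂ^d`. -/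
noncomputable def realInclusion (d : ℕ) : RSpace d →L[ℝ] CSpace d :=
  LinearMap.toContinuousLinearMap
    { toFun := fun x => WithLp.toLp 2 fun j => (x j : ℂ)
      map_add' := fun x y => by ext j; simp
      map_smul' := fun c x => by ext j; simp }

theorem realInclusion_apply {d : ℕ} (x : RSpace d) (j : Fin d) :
    realInclusion d x j = (x j : ℂ) := rfl

theorem complexPoint_smul {d : ℕ} (x v : RSpace d) (t : ℝ) :
    complexPoint x (t • v) = realInclusion d x + t • (Complex.I • realInclusion d v) := by
  ext j
  simp [complexPoint, realInclusion_apply]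
  ring

theorem continuous_mul_of_tsupport_subset {X : Type*} [TopologicalSpace X] {U : Set X}
    (hU : IsOpen U) {g ψ : X → ℂ} (hg : ContinuousOn g U) (hψ : Continuous ψ)
    (hs : tsupport ψ ⊆ U) : Continuous fun x => g x * ψ x :=
  (hg.mul hψ.continuousOn).continuous_of_tsupport_subset hU ((tsupport_mul_subset_right).trans hs)

/-- Along a ray, the pairing of an analytic function with a test function can be differentiated by
moving the derivative to the test function. -/
theorem hasDerivAt_integral_complexPoint_smul {d : ℕ} {U Γ : Set (RSpace d)} (hU : IsOpen U)
    (hΓ : IsOpenCone Γ) {γ : ℝ} {G : CSpace d → ℂ} (hG : AnalyticOnNhd ℂ G (wedge U Γ γ))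
    {v : RSpace d} (hv : v ∈ Γ) {ψ : RSpace d → ℂ} (hψ : ContDiff ℝ ∞ ψ)
    (hc : HasCompactSupport ψ) (hs : tsupport ψ ⊆ U) {t : ℝ} (ht : 0 < t) (htγ : t * ‖v‖ < γ) :
    HasDerivAt (fun t : ℝ => ∫ x, G (complexPoint x (t • v)) * ψ x)
      (-Complex.I * ∫ x, G (complexPoint x (t • v)) * fderiv ℝ ψ x v) t := by
  have hmem : ∀ x ∈ U, ∀ s : ℝ, 0 < s → s * ‖v‖ < γ → complexPoint x (s • v) ∈ wedge U Γ γ :=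
    fun x hx s hs0 hsγ => ⟨x, hx, s • v, hΓ.2 v hv s hs0, by
      rwa [norm_smul, Real.norm_of_nonneg hs0.le], rfl⟩
  have hpt : Continuous fun p : RSpace d × ℝ => complexPoint p.1 (p.2 • v) := by
    simp only [complexPoint_smul]
    fun_prop
  set w : CSpace d := realInclusion d v
  -- By complex linearity of the derivative, `∂_s G(x + i s v) = i G'`, while `G'` is also the
  -- derivative in `x` along `v`. The derivative in `s` can therefore be integrated by parts.
  set G' : ℝ → RSpace d → ℂ := fun s x => fderiv ℂ G (complexPoint x (s • v)) w with hG'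
  set T : Set ℝ := {s | 0 < s ∧ s * ‖v‖ < γ}
  have hGc : ContinuousOn (fun p : RSpace d × ℝ => G (complexPoint p.1 (p.2 • v))) (U ×ˢ T) :=
    hG.continuousOn.comp hpt.continuousOn fun p hp => hmem _ hp.1 _ hp.2.1 hp.2.2
  have hGdc : ContinuousOn (fun p : RSpace d × ℝ => G' p.2 p.1) (U ×ˢ T) :=
    (hG.fderiv.continuousOn.comp hpt.continuousOn
      fun p hp => hmem _ hp.1 _ hp.2.1 hp.2.2).clm_apply continuousOn_const
  have hslice : ∀ {g : RSpace d × ℝ → ℂ}, ContinuousOn g (U ×ˢ T) → ∀ s ∈ T,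
      ContinuousOn (fun x => g (x, s)) U := fun hg s hs =>
    hg.comp (Continuous.prodMk_left s).continuousOn fun x hx => ⟨hx, hs⟩
  have hGd : ∀ x ∈ U, ∀ s ∈ T, HasFDerivAt G (fderiv ℂ G (complexPoint x (s • v)))
      (complexPoint x (s • v)) := fun x hx s hs =>
    ((hG _ (hmem x hx s hs.1 hs.2)).differentiableAt).hasFDerivAt
  have htT : t ∈ T := ⟨ht, htγ⟩
  have hTo : IsOpen T :=
    (isOpen_lt continuous_const continuous_id).inter
      (isOpen_lt (continuous_id.mul continuous_const) continuous_const)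
  -- A compact interval of heights makes `G'` bounded over the support, which provides the
  -- dominating function.
  obtain ⟨r, hr, hrT⟩ := Metric.nhds_basis_closedBall.mem_iff.1 (hTo.mem_nhds htT)
  obtain ⟨B, hB⟩ := (hc.isCompact.prod (isCompact_closedBall t r)).exists_bound_of_continuousOn
    (hGdc.mono (Set.prod_mono hs hrT))
  have hzero : ∀ x ∉ tsupport ψ, ψ x = 0 := fun x hx => image_eq_zero_of_notMem_tsupport hx
  have hint : ∀ {g : RSpace d → ℂ}, ContinuousOn g U → ∀ {χ : RSpace d → ℂ}, Continuous χ →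
      tsupport χ ⊆ tsupport ψ → Integrable fun x => g x * χ x := by
    intro g hg χ hχ hχs
    refine (continuous_mul_of_tsupport_subset hU hg hχ
      (hχs.trans hs)).integrable_of_hasCompactSupport ?_
    exact HasCompactSupport.of_support_subset_isCompact hc.isCompact
      ((subset_tsupport _).trans (tsupport_mul_subset_right.trans hχs))
  have hψc : Continuous ψ := hψ.continuous
  have hψdc : Continuous fun x => fderiv ℝ ψ x v :=
    (hψ.continuous_fderiv (by simp)).clm_apply continuous_const
  have hψds : tsupport (fun x => fderiv ℝ ψ x v) ⊆ tsupport ψ :=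
    tsupport_fderiv_apply_subset ℝ v
  have h1 := (hasDerivAt_integral_of_dominated_loc_of_deriv_le (μ := (volume : Measure (RSpace d)))
    (F := fun (s : ℝ) x => G (complexPoint x (s • v)) * ψ x)
    (F' := fun s x => Complex.I * (G' s x * ψ x)) (x₀ := t) (s := Metric.closedBall t r)
    (bound := fun x => B * ‖ψ x‖) (Metric.closedBall_mem_nhds t hr) ?_ ?_ ?_ ?_ ?_ ?_).2
  · refine h1.congr_deriv ?_
    rw [integral_const_mul, neg_mul, ← mul_neg]
    congr 1
    have hx : ∀ x ∈ U, HasFDerivAt (fun x => G (complexPoint x (t • v)))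
        (((fderiv ℂ G (complexPoint x (t • v))).restrictScalars ℝ).comp (realInclusion d)) x := by
      intro x hx
      have h2 : HasFDerivAt (fun x => complexPoint x (t • v)) (realInclusion d) x := by
        simp only [complexPoint_smul]
        exact (realInclusion d).hasFDerivAt.add_const _
      exact ((hGd x hx t htT).restrictScalars ℝ).comp x h2
    have hfd : ∀ x, fderiv ℝ (fun x => G (complexPoint x (t • v))) x v * ψ x = G' t x * ψ x := by
      intro x
      by_cases hxs : x ∈ tsupport ψ
      · rw [(hx x (hs hxs)).fderiv]
        rfl
      · simp [hzero x hxs]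
    rw [integral_mul_fderiv_eq_neg_fderiv_mul_of_integrable, neg_neg]
    · exact integral_congr_ae (ae_of_all _ fun x => (hfd x).symm)
    · exact (hint (hslice hGdc t htT) hψc le_rfl).congr (ae_of_all _ fun x => (hfd x).symm)
    · exact hint (hslice hGc t htT) hψdc hψds
    · exact hint (hslice hGc t htT) hψc le_rfl
    · exact fun x hxs => (hx x (hs hxs)).differentiableAt
    · exact fun x _ => hψ.differentiable (by simp) x
  · filter_upwards [Metric.closedBall_mem_nhds t hr] with s hsr
    exact (hint (hslice hGc s (hrT hsr)) hψc le_rfl).aestronglyMeasurable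
  · exact hint (hslice hGc t htT) hψc le_rfl
  · exact ((hint (hslice hGdc t htT) hψc le_rfl).const_mul _).aestronglyMeasurable
  · refine ae_of_all _ fun x s hsr => ?_
    by_cases hxs : x ∈ tsupport ψ
    · rw [norm_mul, Complex.norm_I, one_mul, norm_mul]
      gcongr
      exact hB (x, s) ⟨hxs, hsr⟩
    · simp [hzero x hxs]
  · exact (hψc.norm.const_smul B).integrable_of_hasCompactSupport hc.norm.mul_left
  · refine ae_of_all _ fun x s hsr => ?_
    by_cases hxs : x ∈ tsupport ψ
    · have h2 : HasDerivAt (fun s : ℝ => complexPoint x (s • v)) (Complex.I • w) s := by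
        simp only [complexPoint_smul]
        simpa using ((hasDerivAt_id s).smul_const (Complex.I • w)).const_add (realInclusion d x)
      refine ((((hGd x (hs hxs) s (hrT hsr)).restrictScalars ℝ).comp_hasDerivAt s h2).mul_const
        (ψ x)).congr_deriv ?_
      simp [hG', mul_assoc]
    · simp only [hzero x hxs, mul_zero]
      exact hasDerivAt_const _ _

/-! ### A decay estimate in one variable. -/

/-- The product rule telescopes: differentiating the coefficient of one term cancels the derivative
of `J` in the preceding term. -/
theorem hasDerivAt_sum_pow_smul {J : ℕ → ℝ → ℂ} {s : ℝ}
    (hJ : ∀ n, HasDerivAt (J n) (J (n + 1) s) s) (N : ℕ) :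
    HasDerivAt (fun s : ℝ => ∑ n ∈ Finset.range (N + 1), ((-s) ^ n / n.factorial) • J n s)
      (((-s) ^ N / N.factorial) • J (N + 1) s) s := by
  induction N with
  | zero => simpa using hJ 0
  | succ N ih =>
    simp only [Finset.sum_range_succ _ (N + 1)]
    have h1 : HasDerivAt (fun s : ℝ => (-s) ^ (N + 1) / ((N + 1).factorial : ℝ))
        (-((-s) ^ N / N.factorial)) s := by
      refine (((hasDerivAt_neg s).fun_pow (N + 1)).div_const
        ((N + 1).factorial : ℝ)).congr_deriv ?_
      rw [Nat.factorial_succ]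
      push_cast
      have : (N.factorial : ℝ) ≠ 0 := by positivity
      have : (N : ℝ) + 1 ≠ 0 := by positivity
      field_simp
    refine (ih.fun_add (h1.fun_smul (hJ (N + 1)))).congr_deriv ?_
    module

/-- A one-dimensional Paley-Wiener type estimate at the end point of an interval on which the
derivatives of a function are controlled by a Gevrey sequence with an exponentially decaying factor
and an exponential singularity. -/
theorem norm_le_of_gevrey_deriv_bounds {J : ℕ → ℝ → ℂ} {a b A D l ε : ℝ} (hA : 0 ≤ A)
    (hD : 0 < D) (ha : 0 < a) (hl : 0 ≤ l) (hε : 0 < ε) (haD : 16 * (a * D) ≤ 1) (hab : ε + a < b)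
    (hJ : ∀ n, ∀ t, 0 < t → t < b → HasDerivAt (J n) (J (n + 1) t) t)
    (hb : ∀ n, ∀ t, 0 < t → t < b → ‖J n t‖ ≤
      A * Real.exp (a * Real.log 2 / t) * Real.exp (-(l * t)) * (D ^ n * (n.factorial : ℝ) ^ 2)) :
    ‖J 0 ε‖ ≤ 8 * A * Real.exp (-√(l * a)) := by
  -- Taylor polynomial of `J 0` about `ε + s`, evaluated at `ε`; in particular `P N 0 = J 0 ε` for
  -- every `N`.
  set P : ℕ → ℝ → ℂ := fun N s =>
    ∑ n ∈ Finset.range (N + 1), ((-s) ^ n / n.factorial) • J n (ε + s) with hP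
  have hPd : ∀ N, ∀ s, 0 ≤ s → s ≤ a →
      HasDerivAt (P N) (((-s) ^ N / N.factorial) • J (N + 1) (ε + s)) s := fun N s hs hsa =>
    hasDerivAt_sum_pow_smul (J := fun n s => J n (ε + s)) (fun n => by
      simpa using (hJ n (ε + s) (by linarith) (by linarith)).comp_const_add ε s) N
  -- The `1 / N!` of the remainder cancels one factorial up to `N + 1`; the length `a / (N + 1)`
  -- cancels the other, as `(N + 1)! ≤ (N + 1) ^ (N + 1)`.
  have hseg : ∀ (N : ℕ) (p B : ℝ), 0 ≤ p → p ≤ a / (N + 1) → 0 ≤ B →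
      (∀ s, p ≤ s → s ≤ a / (N + 1) →
        ‖J (N + 1) (ε + s)‖ ≤ B * (D ^ (N + 1) * ((N + 1).factorial : ℝ) ^ 2)) →
      ‖P N (a / (N + 1)) - P N p‖ ≤ B * (a * D) ^ (N + 1) * (N + 1) := by
    intro N p B hp hpq hB hJB
    set q := a / ((N : ℝ) + 1) with hq
    have hq0 : 0 < q := by positivity
    have hqa : q ≤ a := div_le_self ha.le (by linarith [(Nat.cast_nonneg N : (0 : ℝ) ≤ N)])
    have h1 := Convex.norm_image_sub_le_of_norm_hasDerivWithin_le (f := P N)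
      (f' := fun s => ((-s) ^ N / N.factorial) • J (N + 1) (ε + s)) (s := Set.Icc p q)
      (C := q ^ N / N.factorial * (B * (D ^ (N + 1) * ((N + 1).factorial : ℝ) ^ 2)))
      (fun s hs => (hPd N s (hp.trans hs.1) (hs.2.trans hqa)).hasDerivWithinAt)
      (fun s hs => by
        have hs0 : 0 ≤ s := hp.trans hs.1
        rw [norm_smul, norm_div, norm_pow, norm_neg, Real.norm_of_nonneg hs0, Real.norm_natCast]
        gcongr
        · exact hs.2
        · exact hJB s hs.1 hs.2)
      (convex_Icc p q) (Set.left_mem_Icc.2 hpq) (Set.right_mem_Icc.2 hpq)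
    refine h1.trans ?_
    rw [Real.norm_of_nonneg (sub_nonneg.2 hpq)]
    have h2 : ((N + 1).factorial : ℝ) ≤ ((N : ℝ) + 1) ^ (N + 1) := by
      exact_mod_cast Nat.factorial_le_pow (N + 1)
    have h3 : ((N + 1).factorial : ℝ) = (N + 1) * N.factorial := by
      rw [Nat.factorial_succ]
      push_cast
      ring
    calc _ ≤ q ^ N / N.factorial * (B * (D ^ (N + 1) * ((N + 1).factorial : ℝ) ^ 2)) * q := by
          gcongr
          linarith
      _ = B * (q ^ (N + 1) * D ^ (N + 1)) * (N + 1) * (N + 1).factorial := by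
          rw [h3]
          field_simp
          ring
      _ ≤ B * (q ^ (N + 1) * D ^ (N + 1)) * (N + 1) * ((N : ℝ) + 1) ^ (N + 1) := by gcongr
      _ = _ := by
          rw [hq, div_pow, mul_pow]
          field_simp
  have hpow2 : ∀ N : ℕ, (N : ℝ) + 1 ≤ 2 ^ N := fun N => by exact_mod_cast N.lt_two_pow_self
  set w := √(l * a)
  have hw0 : 0 ≤ w := Real.sqrt_nonneg _
  have hw2 : w ^ 2 = l * a := Real.sq_sqrt (by positivity)
  have hexp : ∀ q : ℕ, 0 < q → Real.exp (-(l * (a / q))) ≤ 2 ^ q * Real.exp (-w) := by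
    intro q hq
    have hq' : (0 : ℝ) < q := by exact_mod_cast hq
    rw [← Real.rpow_natCast, Real.rpow_def_of_pos two_pos, ← Real.exp_add]
    gcongr
    -- This trades `exp (-l a / q)` for `exp (-√(l a))` at the price `exp (q / 2) ≤ 2 ^ q`, for
    -- every `q` at once.
    have h1 : w ≤ q / 2 + w ^ 2 / q := by
      rw [← sub_nonneg]
      have : q / 2 + w ^ 2 / q - w = ((q - w) ^ 2 + w ^ 2) / (2 * q) := by
        field_simp
        ring
      rw [this]
      positivity
    have h2 : (q : ℝ) / 2 ≤ Real.log 2 * q := by nlinarith [Real.log_two_gt_d9]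
    have h3 : l * (a / q) = w ^ 2 / q := by rw [hw2]; ring
    linarith
  have hJt : ∀ (n q : ℕ) (s : ℝ), 0 < q → a / q ≤ s → s ≤ a →
      ‖J n (ε + s)‖ ≤ A * 2 ^ q * (2 ^ q * Real.exp (-w)) * (D ^ n * (n.factorial : ℝ) ^ 2) := by
    intro n q s hq hqs hsa
    have hq' : (0 : ℝ) < q := by exact_mod_cast hq
    have hs0 : 0 < s := lt_of_lt_of_le (by positivity) hqs
    have h0 : a / q ≤ ε + s := by linarith
    have hlog : 0 ≤ Real.log 2 := Real.log_nonneg one_le_two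
    refine (hb n (ε + s) (by linarith) (by linarith)).trans ?_
    gcongr
    · rw [← Real.rpow_natCast, Real.rpow_def_of_pos two_pos]
      gcongr
      rw [div_le_iff₀ (by linarith), mul_assoc, mul_comm a]
      gcongr
      rwa [div_le_iff₀ hq', mul_comm] at h0
    · refine le_trans ?_ (hexp q hq)
      gcongr
  -- The order goes up while the height goes down. The start `P 0 a` contributes `4`, and passing
  -- from `N` to `N + 1` adds at most `4 * (1 / 2) ^ (N + 1)`, so the total stays below `8`.
  have hbound : ∀ N : ℕ, ‖P N (a / (N + 1))‖ ≤ (8 - 4 * (1 / 2) ^ N) * A * Real.exp (-w) := by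
    intro N
    induction N with
    | zero =>
      have h1 := hJt 0 1 a one_pos (by simp) le_rfl
      simp only [hP, zero_add, Finset.range_one, Finset.sum_singleton, pow_zero, Nat.factorial_zero,
        Nat.cast_one, div_one, one_smul, Nat.cast_zero]
      refine h1.trans (le_of_eq ?_)
      simp only [pow_one, pow_zero, Nat.factorial_zero, Nat.cast_one, one_pow]
      ring
    | succ N ih =>
      have hN0 : (0 : ℝ) ≤ N := Nat.cast_nonneg N
      set p := a / (((N + 1 : ℕ) : ℝ) + 1) with hp
      have hp2 : p = a / ((N + 2 : ℕ) : ℝ) := by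
        rw [hp]
        push_cast
        ring_nf
      have hp0 : 0 < p := by positivity
      have hpq : p ≤ a / (N + 1) := by
        rw [hp]
        push_cast
        gcongr
        linarith
      have hqa : a / ((N : ℝ) + 1) ≤ a := div_le_self ha.le (by linarith)
      have h1 := hseg N p (A * 2 ^ (N + 2) * (2 ^ (N + 2) * Real.exp (-w))) hp0.le hpq
        (by positivity) fun s hs hsq =>
          hJt (N + 1) (N + 2) s (by omega) (hp2 ▸ hs) (hsq.trans hqa)
      have h2 : ‖P (N + 1) p - P N p‖ ≤
          A * 2 ^ (N + 2) * (2 ^ (N + 2) * Real.exp (-w)) * (a * D) ^ (N + 1) := by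
        have e : P (N + 1) p - P N p =
            ((-p) ^ (N + 1) / (N + 1).factorial) • J (N + 1) (ε + p) := by
          simp only [hP]
          rw [Finset.sum_range_succ _ (N + 1), add_sub_cancel_left]
        have h3 := hJt (N + 1) (N + 2) p (by omega) hp2.ge (hpq.trans hqa)
        have h4 : ((N + 1).factorial : ℝ) ≤ (((N + 1 : ℕ) : ℝ) + 1) ^ (N + 1) := by
          refine (show ((N + 1).factorial : ℝ) ≤ ((N + 1 : ℕ) : ℝ) ^ (N + 1) by
            exact_mod_cast Nat.factorial_le_pow (N + 1)).trans ?_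
          gcongr
          linarith
        rw [e, norm_smul, norm_div, norm_pow, norm_neg, Real.norm_of_nonneg hp0.le,
          Real.norm_natCast]
        set E := A * 2 ^ (N + 2) * (2 ^ (N + 2) * Real.exp (-w))
        have hE : 0 ≤ E := by positivity
        calc _ ≤ p ^ (N + 1) / (N + 1).factorial *
              (E * (D ^ (N + 1) * ((N + 1).factorial : ℝ) ^ 2)) := by gcongr
          _ = E * (p ^ (N + 1) * D ^ (N + 1)) * (N + 1).factorial := by
              field_simp
          _ ≤ E * (p ^ (N + 1) * D ^ (N + 1)) * (((N + 1 : ℕ) : ℝ) + 1) ^ (N + 1) := by gcongr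
          _ = _ := by
              rw [hp, div_pow, mul_pow]
              field_simp
      have h5 : ‖P (N + 1) p‖ ≤ ‖P N (a / (N + 1))‖ + ‖P N (a / (N + 1)) - P N p‖ +
          ‖P (N + 1) p - P N p‖ := by
        have e : P (N + 1) p =
            P N (a / (N + 1)) - (P N (a / (N + 1)) - P N p) + (P (N + 1) p - P N p) := by ring
        calc ‖P (N + 1) p‖ = ‖P N (a / (N + 1)) - (P N (a / (N + 1)) - P N p) +
              (P (N + 1) p - P N p)‖ := by rw [← e]
          _ ≤ ‖P N (a / (N + 1)) - (P N (a / (N + 1)) - P N p)‖ + ‖P (N + 1) p - P N p‖ :=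
              norm_add_le _ _
          _ ≤ _ := by
              gcongr
              exact norm_sub_le _ _
      -- Here `a D ≤ 1 / 16` enters: it beats the `4 ^ (N + 2)` from singularity and optimization
      -- together with `N + 2 ≤ 2 ^ (N + 1)`.
      have h6 : A * 2 ^ (N + 2) * (2 ^ (N + 2) * Real.exp (-w)) * (a * D) ^ (N + 1) * (N + 1) +
          A * 2 ^ (N + 2) * (2 ^ (N + 2) * Real.exp (-w)) * (a * D) ^ (N + 1) ≤
          4 * (1 / 2) ^ (N + 1) * A * Real.exp (-w) := by
        have h7 : (N : ℝ) + 2 ≤ 2 ^ (N + 1) := by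
          have := hpow2 (N + 1)
          push_cast at this
          linarith
        calc _ = A * Real.exp (-w) * (2 ^ (N + 2) * 2 ^ (N + 2)) * (a * D) ^ (N + 1) * (N + 2) := by
              ring
          _ ≤ A * Real.exp (-w) * (2 ^ (N + 2) * 2 ^ (N + 2)) * (1 / 16) ^ (N + 1) *
              2 ^ (N + 1) := by
              gcongr
              linarith
          _ = 4 * (2 * 2 * (1 / 16) * 2) ^ (N + 1) * A * Real.exp (-w) := by
              simp only [mul_pow]
              ring
          _ = _ := by norm_num
      have h8 : (1 / 2 : ℝ) ^ N = 2 * (1 / 2) ^ (N + 1) := by ring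
      rw [h8] at ih
      linarith
  -- On the last segment `[0, a / (N + 1)]` the singularity is bounded crudely by its value at `ε`.
  -- This constant depends on `ε` but is multiplied by `(1 / 8) ^ (N + 1)`, and `N → ∞` with `ε`
  -- fixed removes it.
  have hfin : ∀ N : ℕ, ‖J 0 ε‖ ≤ 8 * A * Real.exp (-w) +
      A * Real.exp (a * Real.log 2 / ε) * (1 / 8) ^ (N + 1) := by
    intro N
    have hN0 : (0 : ℝ) ≤ N := Nat.cast_nonneg N
    have hqa : a / ((N : ℝ) + 1) ≤ a := div_le_self ha.le (by linarith)
    have hlog : 0 ≤ Real.log 2 := Real.log_nonneg one_le_two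
    have h1 := hseg N 0 (A * Real.exp (a * Real.log 2 / ε)) le_rfl (by positivity) (by positivity)
      fun s hs hsq => by
        refine (hb (N + 1) (ε + s) (by linarith) (by linarith)).trans
          (mul_le_mul_of_nonneg_right ?_ (by positivity))
        calc _ ≤ A * Real.exp (a * Real.log 2 / ε) * 1 := by
              gcongr
              · linarith
              · rw [Real.exp_le_one_iff]
                have : 0 ≤ l * (ε + s) := by positivity
                linarith
          _ = _ := mul_one _
    have h2 : P N 0 = J 0 ε := by
      simp only [hP]
      rw [Finset.sum_range_succ']
      simp
    have h3 : A * Real.exp (a * Real.log 2 / ε) * (a * D) ^ (N + 1) * (N + 1) ≤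
        A * Real.exp (a * Real.log 2 / ε) * (1 / 8) ^ (N + 1) := by
      have h4 : (N : ℝ) + 1 ≤ 2 ^ (N + 1) := (hpow2 N).trans (by gcongr <;> norm_num)
      calc _ ≤ A * Real.exp (a * Real.log 2 / ε) * (1 / 16) ^ (N + 1) * 2 ^ (N + 1) := by
            gcongr
            linarith
        _ = A * Real.exp (a * Real.log 2 / ε) * (1 / 16 * 2) ^ (N + 1) := by rw [mul_pow]; ring
        _ = _ := by norm_num
    have h5 : ‖P N 0‖ ≤ ‖P N (a / (N + 1))‖ + ‖P N (a / (N + 1)) - P N 0‖ := by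
      rw [norm_sub_rev]
      exact norm_le_norm_add_norm_sub' _ _
    have h6 : (8 - 4 * (1 / 2) ^ N) * A * Real.exp (-w) ≤ 8 * A * Real.exp (-w) := by
      gcongr
      have : (0 : ℝ) ≤ (1 / 2) ^ N := by positivity
      linarith
    rw [h2] at h1 h5
    linarith [hbound N]
  have hlim : Tendsto (fun N : ℕ => 8 * A * Real.exp (-w) +
      A * Real.exp (a * Real.log 2 / ε) * (1 / 8) ^ (N + 1)) atTop
      (𝓝 (8 * A * Real.exp (-w) + A * Real.exp (a * Real.log 2 / ε) * 0)) :=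
    (((tendsto_pow_atTop_nhds_zero_of_lt_one (by norm_num) (by norm_num)).comp
      (tendsto_add_atTop_nat 1)).const_mul _).const_add _
  rw [mul_zero, add_zero] at hlim
  exact ge_of_tendsto' hlim hfin

/-! ### Fourier decay outside the dual cone. -/

/-- The complex linear extension of `x ↦ x · ξ`. -/
noncomputable def complexPairing {d : ℕ} (ξ : RSpace d) : CSpace d →L[ℂ] ℂ :=
  ∑ j, (ξ j : ℂ) • (EuclideanSpace.proj j : CSpace d →L[ℂ] ℂ)

theorem complexPairing_complexPoint_smul {d : ℕ} (ξ x v : RSpace d) (t : ℝ) :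
    complexPairing ξ (complexPoint x (t • v)) =
      ((inner ℝ x ξ : ℝ) : ℂ) + Complex.I * ((t * inner ℝ v ξ : ℝ) : ℂ) := by
  simp only [complexPairing, complexPoint, PiLp.inner_apply, Finset.mul_sum,
    sum_apply, smul_apply, PiLp.proj_apply,
    Complex.ofReal_sum, ← Finset.sum_add_distrib]
  refine Finset.sum_congr rfl fun j _ => ?_
  simp
  ring

theorem exp_complexPairing_complexPoint_smul {d : ℕ} (ξ x v : RSpace d) (t : ℝ) :
    Complex.exp (-Complex.I * complexPairing ξ (complexPoint x (t • v))) =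
      Complex.exp (-Complex.I * ((inner ℝ x ξ : ℝ) : ℂ)) *
        ((Real.exp (t * inner ℝ v ξ) : ℝ) : ℂ) := by
  rw [complexPairing_complexPoint_smul, Complex.ofReal_exp, ← Complex.exp_add]
  congr 1
  linear_combination (-((t * inner ℝ v ξ : ℝ) : ℂ)) * Complex.I_mul_I

theorem norm_exp_complexPairing_complexPoint_smul {d : ℕ} (ξ x v : RSpace d) (t : ℝ) :
    ‖Complex.exp (-Complex.I * complexPairing ξ (complexPoint x (t • v)))‖ =
      Real.exp (t * inner ℝ v ξ) := by
  rw [exp_complexPairing_complexPoint_smul, norm_mul, Complex.norm_real,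
    Real.norm_of_nonneg (Real.exp_pos _).le]
  simp [Complex.norm_exp]

/-- The Fourier transforms of the truncated functions `F(· + i ε v)` decay in the directions in
which `v` is negative, uniformly in `ε`. -/
theorem exists_norm_integral_mul_exp_le {d : ℕ} {U Γ : Set (RSpace d)} (hU : IsOpen U)
    (hΓ : IsOpenCone Γ) {γ : ℝ} (hγ : 0 < γ) {F : CSpace d → ℂ}
    (hF : AnalyticOnNhd ℂ F (wedge U Γ γ)) (hgr : SubexponentialGrowth U Γ F) {v : RSpace d}
    (hv : v ∈ Γ) (hv0 : v ≠ 0) {φ : RSpace d → ℂ} (hφ : IsGevreyTwo φ) (hc : HasCompactSupport φ)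
    (hs : tsupport φ ⊆ U) :
    ∃ C c b : ℝ, 0 ≤ C ∧ 0 < c ∧ 0 < b ∧ ∀ ξ : RSpace d, inner ℝ v ξ ≤ 0 → ∀ ε : ℝ, 0 < ε →
      ε < b → ‖∫ x, F (complexPoint x (ε • v)) *
        (φ x * Complex.exp (-Complex.I * ((inner ℝ x ξ : ℝ) : ℂ)))‖ ≤
        Real.exp (-(ε * inner ℝ v ξ)) * (C * Real.exp (-(c * √(-inner ℝ v ξ)))) := by
  obtain ⟨hφs, D, hD, hφD⟩ := hφ
  obtain ⟨r, hr, hgr⟩ := hgr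
  have hv' : 0 < ‖v‖ := norm_pos_iff.2 hv0
  set b := min γ r / ‖v‖ with hb
  have hb0 : 0 < b := by positivity
  -- The first bound keeps `ε + a < b` for `ε < b / 2`; the second is the smallness required by
  -- `norm_le_of_gevrey_deriv_bounds`, with Gevrey constant `D ‖v‖` in direction `v`.
  set a := min (b / 2) (1 / (16 * (D * ‖v‖))) with ha
  have ha0 : 0 < a := by positivity
  have haD : 16 * (a * (D * ‖v‖)) ≤ 1 := by
    have h1 : a ≤ 1 / (16 * (D * ‖v‖)) := min_le_right _ _
    rw [le_div_iff₀ (by positivity)] at h1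
    linarith
  have hlog : 0 < Real.log 2 := Real.log_pos one_lt_two
  -- At `y = t v` this choice of `δ` gives exactly `exp (a log 2 / t)`. As `a` is dictated by the
  -- cutoff, small `δ` must be allowed.
  obtain ⟨C, hC, hCF⟩ := hgr (a * Real.log 2 * ‖v‖) (by positivity)
  set M := volume.real (tsupport φ) with hM
  have hray : ∀ t, 0 < t → t < b → t * ‖v‖ < γ ∧ t * ‖v‖ < r := fun t _ htb => by
    rw [hb, lt_div_iff₀ hv'] at htb
    exact ⟨htb.trans_le (min_le_left _ _), htb.trans_le (min_le_right _ _)⟩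
  set ψ : ℕ → RSpace d → ℂ := fun n x => iteratedFDeriv ℝ n φ x fun _ => v with hψ
  have hψs : ∀ n, ContDiff ℝ ∞ (ψ n) := fun n =>
    (ContinuousMultilinearMap.apply ℝ (fun _ : Fin n => RSpace d) ℂ fun _ => v).contDiff.comp
      (hφs.iteratedFDeriv_right (m := ∞) (i := n) (by exact_mod_cast le_top))
  have hψt : ∀ n, tsupport (ψ n) ⊆ tsupport φ := fun n =>
    closure_minimal (fun x hx => support_iteratedFDeriv_subset (𝕜 := ℝ) n (fun h0 => hx (by
      simp [hψ, h0]))) (isClosed_tsupport φ)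
  have hψc : ∀ n, HasCompactSupport (ψ n) := fun n =>
    hc.isCompact.of_isClosed_subset (isClosed_tsupport _) (hψt n)
  have hψd : ∀ n x, fderiv ℝ (ψ n) x v = ψ (n + 1) x := fun n x => by
    have h1 : DifferentiableAt ℝ (iteratedFDeriv ℝ n φ) x :=
      (hφs.differentiable_iteratedFDeriv (by exact_mod_cast WithTop.coe_lt_top n)) x
    exact (h1.iteratedFDeriv_succ_apply_left' (m := fun _ => v)).symm
  refine ⟨8 * (C * D * M), √a, b / 2, by positivity, Real.sqrt_pos.2 ha0, by positivity,
    fun ξ hξ ε hε hεb => ?_⟩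
  set l := -inner ℝ v ξ with hl
  have hl0 : 0 ≤ l := by linarith
  set G : CSpace d → ℂ := fun z => F z * Complex.exp (-Complex.I * complexPairing ξ z) with hG
  have hGa : AnalyticOnNhd ℂ G (wedge U Γ γ) := fun z hz =>
    (hF z hz).mul ((analyticAt_const.mul ((complexPairing ξ).analyticAt z)).cexp)
  set J : ℕ → ℝ → ℂ := fun n t =>
    (-Complex.I) ^ n * ∫ x, G (complexPoint x (t • v)) * ψ n x with hJ
  have hJd : ∀ n, ∀ t, 0 < t → t < b → HasDerivAt (J n) (J (n + 1) t) t := by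
    intro n t ht htb
    refine ((hasDerivAt_integral_complexPoint_smul hU hΓ hGa hv (hψs n) (hψc n)
      ((hψt n).trans hs) ht (hray t ht htb).1).const_mul ((-Complex.I) ^ n)).congr_deriv ?_
    simp only [hψd, hJ]
    ring
  have hJb : ∀ n, ∀ t, 0 < t → t < b → ‖J n t‖ ≤ C * D * M * Real.exp (a * Real.log 2 / t) *
      Real.exp (-(l * t)) * ((D * ‖v‖) ^ n * (n.factorial : ℝ) ^ 2) := by
    intro n t ht htb
    have h0 : ∫ x, G (complexPoint x (t • v)) * ψ n x =
        ∫ x in tsupport φ, G (complexPoint x (t • v)) * ψ n x := by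
      refine (setIntegral_eq_integral_of_forall_compl_eq_zero fun x hx => ?_).symm
      rw [image_eq_zero_of_notMem_tsupport fun h => hx (hψt n h), mul_zero]
    have h1 : ∀ x ∈ tsupport φ, ‖G (complexPoint x (t • v)) * ψ n x‖ ≤
        C * Real.exp (a * Real.log 2 / t) * Real.exp (-(l * t)) *
          (D ^ (n + 1) * (n.factorial : ℝ) ^ 2 * ‖v‖ ^ n) := by
      intro x hx
      have h2 := hCF x (hs hx) (t • v) (hΓ.2 v hv t ht) (smul_ne_zero ht.ne' hv0)
      rw [norm_smul, Real.norm_of_nonneg ht.le, mul_div_mul_right _ _ hv'.ne'] at h2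
      have h3 : ‖ψ n x‖ ≤ D ^ (n + 1) * (n.factorial : ℝ) ^ 2 * ‖v‖ ^ n := by
        refine (ContinuousMultilinearMap.le_opNorm _ _).trans ?_
        rw [Finset.prod_const, Finset.card_univ, Fintype.card_fin]
        gcongr
        exact hφD n x
      rw [hG, norm_mul, norm_mul, norm_exp_complexPairing_complexPoint_smul,
        show t * inner ℝ v ξ = -(l * t) by rw [hl]; ring]
      gcongr
      exact h2 (hray t ht htb).2
    rw [hJ, norm_mul, norm_pow, norm_neg, Complex.norm_I, one_pow, one_mul, h0]
    refine (norm_setIntegral_le_of_norm_le_const hc.isCompact.measure_lt_top h1).trans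
      (le_of_eq ?_)
    rw [mul_pow]
    ring
  have hfin := norm_le_of_gevrey_deriv_bounds (b := b) (by positivity) (by positivity) ha0 hl0 hε
    haD (by linarith [min_le_left (b / 2) (1 / (16 * (D * ‖v‖)))]) hJd hJb
  -- The exponential is evaluated at height `ε` in `J 0` but at real points in the claim; the
  -- quotient tends to `1` as `ε → 0`.
  have hJ0 : J 0 ε = ((Real.exp (ε * inner ℝ v ξ) : ℝ) : ℂ) * ∫ x, F (complexPoint x (ε • v)) *
      (φ x * Complex.exp (-Complex.I * ((inner ℝ x ξ : ℝ) : ℂ))) := by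
    simp only [hJ, hG, hψ, pow_zero, one_mul, exp_complexPairing_complexPoint_smul,
      iteratedFDeriv_zero_apply]
    rw [← integral_const_mul]
    congr 1
    funext x
    ring
  rw [hJ0, norm_mul, Complex.norm_real, Real.norm_of_nonneg (Real.exp_pos _).le] at hfin
  rw [Real.exp_neg, inv_mul_eq_div, le_div_iff₀ (Real.exp_pos _), mul_comm]
  rwa [mul_comm l a, Real.sqrt_mul ha0.le] at hfin

/-! ### Wave front sets of boundary values. -/

/-- Boundary values of analytic functions of subexponential growth are regular in the directions
outside the dual cone. -/
theorem microRegular_of_isBoundaryValue {d : ℕ} {U Γ : Set (RSpace d)} (hU : IsOpen U)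
    (hΓ : IsOpenCone Γ) {γ : ℝ} (hγ : 0 < γ) {F : CSpace d → ℂ}
    (hF : AnalyticOnNhd ℂ F (wedge U Γ γ)) (hgr : SubexponentialGrowth U Γ F)
    {X : Submodule ℂ (RSpace d → ℂ)}
    (hX : ∀ φ : RSpace d → ℂ, IsGevreyTwo φ → HasCompactSupport φ → tsupport φ ⊆ U → φ ∈ X)
    {u : X →ₗ[ℂ] ℂ} (hu : IsBoundaryValue F Γ u) (k : UltraType) {ρ σ : ℝ} (hρ : 0 < ρ)
    (hσ : 1 < σ) {x₀ ξ₀ : RSpace d} (hx₀ : x₀ ∈ U) (hξ₀ : ξ₀ ∉ dualConeSet Γ) :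
    MicroRegular k ρ σ U u x₀ ξ₀ := by
  simp only [dualConeSet, Set.mem_ofPred_eq, not_forall, not_le] at hξ₀
  obtain ⟨v, hv, hvξ⟩ := hξ₀
  have hv0 : v ≠ 0 := by
    rintro rfl
    simp at hvξ
  have hξ0 : 0 < ‖ξ₀‖ := norm_pos_iff.2 (by
    rintro rfl
    simp at hvξ)
  obtain ⟨φ, hφ, hc, hs, h1⟩ := exists_isGevreyTwo_cutoff x₀ (hU.mem_nhds hx₀)
  obtain ⟨C, c, b, hC, hc0, hb, hest⟩ :=
    exists_norm_integral_mul_exp_le hU hΓ hγ hF hgr hv hv0 hφ hc hs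
  -- Half the value at `ξ₀` of `-v · ξ / |ξ|`, so that `ξ₀` lies strictly inside the cone `v · ξ <
  -- -q |ξ|`. On this cone `√(-v · ξ)` controls `√q √|ξ|`; the strict inequality excludes `ξ = 0`.
  set q := -inner ℝ v ξ₀ / (2 * ‖ξ₀‖) with hq
  have hq0 : 0 < q := div_pos (by linarith) (by positivity)
  have hK : tsupport φ ∈ 𝓝 x₀ := by
    filter_upwards [h1] with x hx
    exact subset_tsupport φ (by simp [hx])
  refine ⟨{ξ | inner ℝ v ξ < -(q * ‖ξ‖)}, ⟨?_, ?_⟩, ?_, tsupport φ, hc, hK, ⟨φ, hX φ hφ hc hs⟩,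
    hφ.mem_testSpace hc hs k hρ hσ, le_rfl, h1, ?_⟩
  · exact isOpen_lt (by fun_prop) (by fun_prop)
  · intro ξ hξ t ht
    simp only [Set.mem_ofPred_eq, inner_smul_right, norm_smul, Real.norm_of_nonneg ht.le] at hξ ⊢
    nlinarith
  · have : q * ‖ξ₀‖ = -inner ℝ v ξ₀ / 2 := by
      rw [hq]
      field_simp
    simp only [Set.mem_ofPred_eq]
    linarith
  · have key : ∀ h : ℝ, 0 < h → ∃ A : ℝ, 0 < A ∧ ∀ ξ ∈ {ξ | inner ℝ v ξ < -(q * ‖ξ‖)},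
        ∃ ψ : X, (∀ x : RSpace d, (ψ : RSpace d → ℂ) x =
            φ x * Complex.exp (-Complex.I * ((inner ℝ x ξ : ℝ) : ℂ))) ∧
          ‖u ψ‖ ≤ A * Real.exp (-assocT ρ σ h ‖ξ‖) := by
      intro h hh
      -- The slope `c √q` is the rate of decay available on the cone.
      obtain ⟨B, hB⟩ := exists_assocT_le_add_mul_sqrt (δ := c * √q) hρ hσ hh (by positivity)
      refine ⟨(C + 1) * Real.exp B, by positivity, fun ξ hξ => ?_⟩
      have hξ' : inner ℝ v ξ < -(q * ‖ξ‖) := hξ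
      have hξn : 0 < ‖ξ‖ := norm_pos_iff.2 (by
        rintro rfl
        simp at hξ')
      have hneg : inner ℝ v ξ ≤ 0 := by
        have : 0 < q * ‖ξ‖ := by positivity
        linarith
      have hts : tsupport (fun x => φ x * Complex.exp (-Complex.I * ((inner ℝ x ξ : ℝ) : ℂ))) ⊆
          tsupport φ := tsupport_mul_subset_left
      refine ⟨⟨_, hX _ (hφ.mul_exp ξ) (hc.isCompact.of_isClosed_subset (isClosed_tsupport _) hts)
        (hts.trans hs)⟩, fun x => rfl, ?_⟩
      set ψ : X := ⟨_, hX _ (hφ.mul_exp ξ)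
        (hc.isCompact.of_isClosed_subset (isClosed_tsupport _) hts) (hts.trans hs)⟩
      have hlim : Tendsto (fun ε : ℝ => ε • v) (𝓝[>] 0) (𝓝[Γ] 0) := by
        refine tendsto_nhdsWithin_iff.2 ⟨?_, ?_⟩
        · have : Continuous fun ε : ℝ => ε • v := by fun_prop
          exact (this.tendsto' 0 0 (zero_smul ℝ v)).mono_left nhdsWithin_le_nhds
        · filter_upwards [self_mem_nhdsWithin] with ε hε
          exact hΓ.2 v hv ε hε
      have hlim2 : Tendsto (fun ε : ℝ => Real.exp (-(ε * inner ℝ v ξ)) *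
          (C * Real.exp (-(c * √(-inner ℝ v ξ))))) (𝓝[>] 0)
          (𝓝 (C * Real.exp (-(c * √(-inner ℝ v ξ))))) := by
        have : Continuous fun ε : ℝ => Real.exp (-(ε * inner ℝ v ξ)) *
          (C * Real.exp (-(c * √(-inner ℝ v ξ)))) := by fun_prop
        exact (this.tendsto' 0 _ (by simp)).mono_left nhdsWithin_le_nhds
      have hle : ‖u ψ‖ ≤ C * Real.exp (-(c * √(-inner ℝ v ξ))) := by
        refine le_of_tendsto_of_tendsto ((hu ψ).comp hlim).norm hlim2 ?_
        filter_upwards [Ioo_mem_nhdsGT hb] with ε hε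
        exact hest ξ hneg ε hε.1 hε.2
      have hT := hB ‖ξ‖ hξn
      have hsq : √q * √‖ξ‖ ≤ √(-inner ℝ v ξ) := by
        rw [← Real.sqrt_mul hq0.le]
        exact Real.sqrt_le_sqrt (by linarith)
      have hsq' := mul_le_mul_of_nonneg_left hsq hc0.le
      calc ‖u ψ‖ ≤ C * Real.exp (-(c * √(-inner ℝ v ξ))) := hle
        _ ≤ (C + 1) * Real.exp (B + -assocT ρ σ h ‖ξ‖) := by
            gcongr
            · linarith
            · linarith
        _ = _ := by rw [Real.exp_add, mul_assoc]
    cases k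
    · exact key
    · exact ⟨1, one_pos, key 1 one_pos⟩

theorem waveFront_subset_of_isBoundaryValue {d : ℕ} {U Γ : Set (RSpace d)} (hU : IsOpen U)
    (hΓ : IsOpenCone Γ) {γ : ℝ} (hγ : 0 < γ) {F : CSpace d → ℂ}
    (hF : AnalyticOnNhd ℂ F (wedge U Γ γ)) (hgr : SubexponentialGrowth U Γ F)
    {X : Submodule ℂ (RSpace d → ℂ)}
    (hX : ∀ φ : RSpace d → ℂ, IsGevreyTwo φ → HasCompactSupport φ → tsupport φ ⊆ U → φ ∈ X)
    {u : X →ₗ[ℂ] ℂ} (hu : IsBoundaryValue F Γ u) (k : UltraType) {ρ σ : ℝ} (hρ : 0 < ρ)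
    (hσ : 1 < σ) : waveFront k ρ σ U u ⊆ U ×ˢ dualConeSet Γ := by
  rintro ⟨x₀, ξ₀⟩ ⟨hx₀, _, hreg⟩
  refine ⟨hx₀, ?_⟩
  by_contra hξ₀
  exact hreg (microRegular_of_isBoundaryValue hU hΓ hγ hF hgr hX hu k hρ hσ hx₀ hξ₀)

theorem mainTheorem2 {d : ℕ} (σ : ℝ) (hσ : 1 < σ) (U Γ : Set (RSpace d)) (hU : IsOpen U)
    (hΓ : IsOpenCone Γ) (γ : ℝ) (hγ : 0 < γ) (F : CSpace d → ℂ)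
    (hF : AnalyticOnNhd ℂ F (wedge U Γ γ)) :
    -- boundary values in the dual of the projective limit
    (∀ (k : UltraType) (u : testSpaceInter k σ U →ₗ[ℂ] ℂ),
      IsUltradistributionInter k σ U u →
      (∃ A : ℝ, 0 < A ∧ ∃ H : ℝ, 0 < H ∧ LogGrowth σ A H U Γ γ F) →
      IsBoundaryValue F Γ u →
      waveFrontUnion k σ U u ⊆ U ×ˢ dualConeSet Γ) ∧
    -- boundary values in the dual of the inductive limit
    (∀ (k : UltraType) (u : testSpaceUnion k σ U →ₗ[ℂ] ℂ),
      IsUltradistributionUnion k σ U u →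
      (∀ H : ℝ, 0 < H → ∃ A : ℝ, 0 < A ∧ LogGrowth σ A H U Γ γ F) →
      IsBoundaryValue F Γ u →
      waveFrontInter k σ U u ⊆ U ×ˢ dualConeSet Γ) ∧
    -- Roumieu case for fixed `τ`
    (∀ (τ : ℝ), 0 < τ →
      ∀ u : testSpace .roumieu (τ / 2 ^ (σ - 1)) σ U →ₗ[ℂ] ℂ,
      IsUltradistribution .roumieu (τ / 2 ^ (σ - 1)) σ U u →
      (∀ H : ℝ, 0 < H → ∃ A : ℝ, 0 < A ∧ AssocGrowth ((2 ^ σ - 1) * τ) σ A H U Γ γ F) →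
      IsBoundaryValue F Γ u →
      waveFront .roumieu ((2 ^ σ - 1) * τ) σ U u ⊆ U ×ˢ dualConeSet Γ) ∧
    -- Beurling case for fixed `τ`
    (∀ (τ : ℝ), 0 < τ →
      ∀ u : testSpace .beurling (τ / 2 ^ (σ - 1)) σ U →ₗ[ℂ] ℂ,
      IsUltradistribution .beurling (τ / 2 ^ (σ - 1)) σ U u →
      (∃ A : ℝ, 0 < A ∧ ∃ H : ℝ, 0 < H ∧ AssocGrowth ((2 ^ σ - 1) * τ) σ A H U Γ γ F) →
      IsBoundaryValue F Γ u →
      waveFront .beurling ((2 ^ σ - 1) * τ) σ U u ⊆ U ×ˢ dualConeSet Γ) := by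
  refine ⟨fun k u _ hgr hu => ?_, fun k u _ hgr hu => ?_, fun τ hτ u _ hgr hu => ?_,
    fun τ hτ u _ hgr hu => ?_⟩
  · obtain ⟨A, hA, H, hH, hgr⟩ := hgr
    refine Set.iUnion₂_subset fun τ hτ => waveFront_subset_of_isBoundaryValue hU hΓ hγ hF
      (hgr.subexponentialGrowth hσ hA hH hγ) (fun φ hφ hc hs => ?_) hu k hτ hσ
    exact (Submodule.mem_iInf _).2 fun τ => hφ.mem_testSpace hc hs k τ.2 hσ
  · obtain ⟨A, hA, hgr⟩ := hgr 1 one_pos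
    -- An intersection lies in each of its members; the index `1` is an arbitrary choice.
    refine (Set.iInter₂_subset 1 (Set.mem_Ioi.2 one_pos)).trans
      (waveFront_subset_of_isBoundaryValue hU hΓ hγ hF
        (hgr.subexponentialGrowth hσ hA one_pos hγ) (fun φ hφ hc hs => ?_) hu k one_pos hσ)
    exact (mem_testSpaceUnion k hσ U φ).2 ⟨1, one_pos, hφ.mem_testSpace hc hs k one_pos hσ⟩
  · obtain ⟨A, hA, hgr⟩ := hgr 1 one_pos
    have hρ : 0 < (2 ^ σ - 1) * τ :=
      mul_pos (sub_pos.2 (Real.one_lt_rpow one_lt_two (by linarith))) hτ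
    exact waveFront_subset_of_isBoundaryValue hU hΓ hγ hF
      (hgr.subexponentialGrowth hρ hσ hA one_pos hγ)
      (fun φ hφ hc hs => hφ.mem_testSpace hc hs _ (by positivity) hσ) hu _ hρ hσ
  · obtain ⟨A, hA, H, hH, hgr⟩ := hgr
    have hρ : 0 < (2 ^ σ - 1) * τ :=
      mul_pos (sub_pos.2 (Real.one_lt_rpow one_lt_two (by linarith))) hτ
    exact waveFront_subset_of_isBoundaryValue hU hΓ hγ hF
      (hgr.subexponentialGrowth hρ hσ hA hH hγ)
      (fun φ hφ hc hs => hφ.mem_testSpace hc hs _ (by positivity) hσ) hu _ hρ hσ
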